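/- **Convergence of full-graph training with MSE.** Let $G$ be an undirected simple graph on $n$ nodes with adjacency matrix $A$ and maximal degree $d_{\max}$, let a subset of $n_{\text{train}}$ nodes be the training set, and let $\tilde{\mathbf A}$ be the matrix of the training rows of the normalized adjacency matrix with self-loops, $$\tilde{\mathbf A}_{ik}=(D^{\rm in}_{i}+1)^{-1/2}(A+I)_{ik}(D^{\rm out}_{k}+1)^{-1/2},\qquad i \text{ a training node},\ k \text{ any node},$$ where $D^{\rm in}_i$ is the degree of $i$, and $D^{\rm out}_k$ is either the degree of $k$ in $G$ or the number of training neighbours of $k$ (the result holds under both conventions). Let $r\ge 2$ be the feature dimension, $h\ge 2$ the output (hidden) dimension, $\sigma(x)=\sqrt2\max(x,0)$, and let $\mathbf W^*\in\mathbb R^{h\times r}$ be ground truth parameters whose rows have Euclidean norm $1$. The one-layer GNN with parameters $\mathbf W\in\mathbb R^{h\times r}$ outputs $\sigma(\tilde{\mathbf A}\mathbf X\mathbf W^\top)$, and the (expected) training loss is $$L(\mathbf W)=\mathbb E_{\mathbf X}\Big[\frac1{n_{\text{train}}}\sum_{i\in\text{training set}}\tfrac12\big\|\sigma(\tilde{\mathbf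 a}_i\mathbf X\mathbf W^\top)-\sigma(\tilde{\mathbf a}_i\mathbf X\mathbf W^{*\top})\big\|_2^2\Big],$$ where $\tilde{\mathbf a}_i$ is the row of $\tilde{\mathbf A}$ at $i$ and the rows of $\mathbf X\in\mathbb R^{n\times r}$ are i.i.d. $N(0,I_r)$. Full-graph training is gradient descent $\mathbf W_{t+1}=\mathbf W_t-\eta_t\nabla L(\mathbf W_t)$, where the rows of $\mathbf W_0$ are independent $N(0,\kappa^2I_r)$, $\kappa>0$. For all $M>0$, $a>0$ and $c\in(0,\tfrac16)$ there is a constant $C>0$, depending only on $M,a,c$, such that the following holds whenever $\kappa\sqrt r\le M$ and $C_1\le d_{\max}\le C_2\,n_{\text{train}}^{3/4}$ for some $C_1,C_2\in(0,1)$. For all learning rates $\eta_t\in\Big[\frac{c\,d_{\max}^3}{\pi n_{\text{train}}^3},\frac1{6\pi d_{\max}}\Big]$ and every $\epsilon\in(0,1)$ there is an integer $T$ (not depending on $\mathbf W_0$) with $$T\le C\,n_{\text{train}}^{7/2}\,h^2\,d_{\max}^{-1/2}\,\epsilon^{-1}\log(h^2/\epsilon)$$ such that, with probability at least $1-(n_{\text{train}}h)^{-a}$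 over $\mathbf W_0$, the loss $L$ is differentiable at every iterate $\mathbf W_t$ and $L(\mathbf W_t)\le\epsilon$ for all $t\ge T$; in particular $L(\mathbf W_T)\le\epsilon$. -/

import Mathlib

open scoped NNReal ENNReal
open MeasureTheory ProbabilityTheory

noncomputable section

namespace FullGraphGNN

/-- The rescaled ReLU activation `σ(x) = √2 · max(x, 0)`. -/
def relu (x : ℝ) : ℝ := √2 * max x 0

/-- Out-degree of node `k` in the training adjacency matrix (rows: training nodes, columns: all
nodes), i.e. the `k`-th column sum of that matrix. -/
def trainOutDegree {n : ℕ} (G : SimpleGraph (Fin n)) [DecidableRel G.Adj]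
    (train : Finset (Fin n)) (k : Fin n) : ℕ :=
  (train.filter fun i => G.Adj i k).card

/-- The training rows of the normalized adjacency matrix with self-loops,
`(D_in + I)^(-1/2) (A + I) (D_out + I)^(-1/2)`, where `D_in` is the diagonal matrix of the
(in-)degrees of the training nodes and `D_out` the diagonal matrix of `dOut`. -/
def normAdj {n : ℕ} (G : SimpleGraph (Fin n)) [DecidableRel G.Adj] (train : Finset (Fin n))
    (dOut : Fin n → ℕ) : Matrix train (Fin n) ℝ :=
  Matrix.of fun i k =>
    (√((G.degree (i : Fin n) : ℝ) + 1))⁻¹ *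
      (G.adjMatrix ℝ + 1) (i : Fin n) k * (√((dOut k : ℝ) + 1))⁻¹

/-- Output `σ(Ã X Wᵀ)` of the one-layer GNN; row `i` is the output on training node `i`. -/
def gnnOutput {n r h : ℕ} {train : Finset (Fin n)} (A : Matrix train (Fin n) ℝ)
    (X : Matrix (Fin n) (Fin r) ℝ) (W : Matrix (Fin h) (Fin r) ℝ) : Matrix train (Fin h) ℝ :=
  (A * X * W.transpose).map relu

/-- Empirical MSE risk for features `X`: the average over the training nodes of half the squared
Euclidean distance between the output of the network with parameters `W` and the target, which is
the output of the network with the ground truth parameters `Wstar`. -/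
def empiricalRisk {n r h : ℕ} {train : Finset (Fin n)} (A : Matrix train (Fin n) ℝ)
    (Wstar W : Matrix (Fin h) (Fin r) ℝ) (X : Matrix (Fin n) (Fin r) ℝ) : ℝ :=
  (train.card : ℝ)⁻¹ *
    ∑ i : train, (1 / 2 : ℝ) * ∑ j : Fin h, (gnnOutput A X W i j - gnnOutput A X Wstar i j) ^ 2

/-- Law of the feature matrix: the rows are i.i.d. `N(0, I_r)`. -/
def featureLaw (n r : ℕ) : Measure (Fin n → Fin r → ℝ) :=
  Measure.pi fun _ => Measure.pi fun _ => gaussianReal 0 1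

/-- The parameter space `ℝ^{h × r}` with the Frobenius inner product. -/
abbrev Params (h r : ℕ) : Type := EuclideanSpace ℝ (Fin h × Fin r)

/-- A parameter vector read as an `h × r` matrix. -/
def Params.toMatrix {h r : ℕ} (W : Params h r) : Matrix (Fin h) (Fin r) ℝ :=
  Matrix.of fun j l => W (j, l)

/-- Expected training risk: the expectation of the empirical MSE risk over the Gaussian
node features. -/
def trainRisk {n r h : ℕ} {train : Finset (Fin n)} (A : Matrix train (Fin n) ℝ)
    (Wstar : Matrix (Fin h) (Fin r) ℝ) (W : Params h r) : ℝ :=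
  ∫ X, empiricalRisk A Wstar W.toMatrix (Matrix.of X) ∂(featureLaw n r)

/-- Gradient descent `W_{t+1} = W_t - η_t ∇L(W_t)` from `W₀`. -/
def gradDescent {h r : ℕ} (L : Params h r → ℝ) (η : ℕ → ℝ) (W₀ : Params h r) : ℕ → Params h r
  | 0 => W₀
  | t + 1 => gradDescent L η W₀ t - η t • gradient L (gradDescent L η W₀ t)

/-- Gaussian initialization: the rows of `W₀` are independent `N(0, κ² I_r)`, i.e. all entries are
independent `N(0, κ²)`. -/
def initLaw (h r : ℕ) (κ : ℝ) : Measure (Params h r) :=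
  (Measure.pi fun _ : Fin h × Fin r => gaussianReal 0 ⟨κ ^ 2, sq_nonneg κ⟩).map
    (MeasurableEquiv.toLp 2 (Fin h × Fin r → ℝ))

end FullGraphGNN

end

/-!
Why full-graph gradient descent converges.

Since the features are Gaussian, the pre-activation of neuron `j` at a training node is, up to the
norm of a row of the normalized adjacency matrix, a linear form in a standard Gaussian vector. So
the expected risk is `S / 2` times a sum over neurons of the loss of one rectified neuron on
isotropic Gaussian input (`trainRisk_eq`), where `S` is the mean squared row norm of the normalized
adjacency matrix, which lies in `[1 / (d_max + 1), 1]`. With `θ` the angle between the weights `w`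
and the unit target `v`, the one-neuron loss is `‖w‖² + 1 - 2 ‖w‖ k(cos θ)`, where `k` is the
arc-cosine kernel (`integral_relu_inner_mul_relu_inner`). The kernel is continuously differentiable,
so the risk is differentiable at every point with no vanishing row (`hasGradientAt_trainRisk`).

A gradient step with effective step size `s = η S` moves `w` inside the plane spanned by `w` and
`v`, with nonnegative coefficients. In coordinates `x` along `v` and `y > 0` across it, `y` stays
positive, so no iterate reaches the singularity at the origin. If the angle with the target is
obtuse, the quantity `(x² + y²) / y` first drops below `4 / 3` geometrically (`sq_div_next_le`), and
from then on the slope `-x / y` decreases geometrically (`one_add_neg_div_next_le`), so the angle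
becomes acute after a total step length logarithmic in the initial data. Then `x` grows to `1 / 4`
(`le_nextX_of_nonneg`), after which `|x - 1| + 8 y` contracts (`dist_next_le`) and dominates the
square root of the loss (`neuronLoss_le`). The total length needed is logarithmic in the initial
slope, the initial size and the accuracy (`dist_le_of_planar_dynamics`).

For the Gaussian initialization, outside an event of probability `(m h)^(-a)`, where `m` is the
number of training nodes, the initial slope and size are polynomial in `m h` uniformly in the
feature dimension and in `κ` (`initLaw_bad_le`): the component of `w` along a unit vector
orthogonal to `v` has bounded density at scale `κ`, and the second moments of the component along
`v` and of the norm are `κ²` and `κ² r ≤ M²`. Dividing the resulting logarithm by the smallest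
effective step size gives the number of steps (`log_target_le`, `four_mul_ceil_le`).
-/

namespace FullGraphGNN

/-! ### The arc-cosine kernel -/

/-- The arc-cosine kernel of degree one, as a function of the cosine `c`. Clamping of `√` and
`arccos` outside `[-1, 1]` makes it continuously differentiable on all of `ℝ`. -/
noncomputable def reluKernel (c : ℝ) : ℝ :=
  (√(1 - c ^ 2) + (Real.pi - Real.arccos c) * c) / Real.pi

lemma reluKernel_one : reluKernel 1 = 1 := by
  simp [reluKernel, Real.pi_ne_zero]

lemma reluKernel_cos {θ : ℝ} (h0 : 0 ≤ θ) (hπ : θ ≤ Real.pi) :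
    reluKernel (Real.cos θ) = (Real.sin θ + (Real.pi - θ) * Real.cos θ) / Real.pi := by
  have : √(1 - Real.cos θ ^ 2) = Real.sin θ := by
    rw [← Real.sin_sq, Real.sqrt_sq (Real.sin_nonneg_of_nonneg_of_le_pi h0 hπ)]
  rw [reluKernel, this, Real.arccos_cos h0 hπ]

lemma continuous_reluKernel : Continuous reluKernel := by
  unfold reluKernel; fun_prop

/-- At `±1` neither summand of the kernel is differentiable; there the derivative is obtained as the
limit of the derivatives at nearby points. -/
lemma hasDerivAt_reluKernel (c : ℝ) :
    HasDerivAt reluKernel ((Real.pi - Real.arccos c) / Real.pi) c := by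
  have key : ∀ x : ℝ, x ≠ -1 → x ≠ 1 →
      HasDerivAt reluKernel ((Real.pi - Real.arccos x) / Real.pi) x := by
    intro x h1 h2
    have hne : 1 - x ^ 2 ≠ 0 := by
      intro h
      have : (x + 1) * (x - 1) = 0 := by linarith
      rcases mul_eq_zero.mp this with h | h
      · exact h1 (by linarith)
      · exact h2 (by linarith)
    have hp : HasDerivAt (fun y : ℝ => 1 - y ^ 2) (-(2 * x)) x := by
      simpa using (hasDerivAt_pow 2 x).const_sub 1
    have hs := hp.sqrt hne
    have ha := ((Real.hasDerivAt_arccos h1 h2).const_sub Real.pi).mul (hasDerivAt_id x)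
    have := (hs.add ha).div_const Real.pi
    refine this.congr_deriv ?_
    simp only [id]
    congr 1
    rcases eq_or_ne (√(1 - x ^ 2)) 0 with h0 | h0
    · simp [h0]
    · field_simp
      ring
  have hg : Continuous fun x => (Real.pi - Real.arccos x) / Real.pi := by fun_prop
  have key2 : ∀ x : ℝ, x ≠ -1 →
      HasDerivAt reluKernel ((Real.pi - Real.arccos x) / Real.pi) x := by
    intro x h1
    rcases eq_or_ne x 1 with rfl | h2
    · have hd : ∀ y ∈ Set.Ioo (0 : ℝ) 2, y ≠ 1 → HasDerivAt reluKernel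
          ((Real.pi - Real.arccos y) / Real.pi) y := fun y hy h =>
        key y (by linarith [hy.1]) h
      have hl : HasDerivWithinAt reluKernel ((Real.pi - Real.arccos 1) / Real.pi)
          (Set.Iic 1) 1 := by
        refine hasDerivWithinAt_Iic_of_tendsto_deriv (s := Set.Ioo 0 1)
          (fun y hy => (hd y ⟨hy.1, by linarith [hy.2]⟩
            hy.2.ne).differentiableAt.differentiableWithinAt)
          continuous_reluKernel.continuousWithinAt (Ioo_mem_nhdsLT (by norm_num)) ?_
        refine (hg.tendsto 1 |>.mono_left nhdsWithin_le_nhds).congr' ?_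
        filter_upwards [Ioo_mem_nhdsLT (show (0 : ℝ) < 1 by norm_num)] with y hy
        exact (hd y ⟨hy.1, by linarith [hy.2]⟩ hy.2.ne).deriv.symm
      have hr : HasDerivWithinAt reluKernel ((Real.pi - Real.arccos 1) / Real.pi)
          (Set.Ici 1) 1 := by
        refine hasDerivWithinAt_Ici_of_tendsto_deriv (s := Set.Ioo 1 2)
          (fun y hy => (hd y ⟨by linarith [hy.1], hy.2⟩
            hy.1.ne').differentiableAt.differentiableWithinAt)
          continuous_reluKernel.continuousWithinAt (Ioo_mem_nhdsGT (by norm_num)) ?_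
        refine (hg.tendsto 1 |>.mono_left nhdsWithin_le_nhds).congr' ?_
        filter_upwards [Ioo_mem_nhdsGT (show (1 : ℝ) < 2 by norm_num)] with y hy
        exact (hd y ⟨by linarith [hy.1], hy.2⟩ hy.1.ne').deriv.symm
      simpa using hl.union hr
    · exact key x h1 h2
  rcases eq_or_ne c (-1) with rfl | h
  · exact hasDerivAt_of_hasDerivAt_of_ne (g := fun x => (Real.pi - Real.arccos x) / Real.pi)
      key2 continuous_reluKernel.continuousAt hg.continuousAt
  · exact key2 c h

/-- The kernel dominates the identity on `[-1, 1]`. -/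
lemma le_reluKernel {c : ℝ} (h1 : -1 ≤ c) (h2 : c ≤ 1) : c ≤ reluKernel c := by
  obtain ⟨θ, h0, hπ, rfl⟩ : ∃ θ, 0 ≤ θ ∧ θ ≤ Real.pi ∧ Real.cos θ = c :=
    ⟨Real.arccos c, Real.arccos_nonneg c, Real.arccos_le_pi c, Real.cos_arccos h1 h2⟩
  rw [reluKernel_cos h0 hπ, le_div_iff₀ Real.pi_pos]
  have hs : θ * Real.cos θ ≤ Real.sin θ := by
    rcases le_or_gt (Real.pi / 2) θ with h | h
    · have : Real.cos θ ≤ 0 := Real.cos_nonpos_of_pi_div_two_le_of_le h (by linarith)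
      have := Real.sin_nonneg_of_nonneg_of_le_pi h0 hπ
      nlinarith
    · have hc : 0 < Real.cos θ := Real.cos_pos_of_mem_Ioo ⟨by linarith [Real.pi_pos], h⟩
      have := Real.le_tan h0 h
      rw [Real.tan_eq_sin_div_cos, le_div_iff₀ hc] at this
      exact this
  linarith

/-! ### Gaussian expectations of products of rectified linear forms -/

section Gaussian

variable {E F : Type*} [NormedAddCommGroup E] [InnerProductSpace ℝ E] [FiniteDimensional ℝ E]
  [MeasurableSpace E] [BorelSpace E]
  [NormedAddCommGroup F] [InnerProductSpace ℝ F] [FiniteDimensional ℝ F]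
  [MeasurableSpace F] [BorelSpace F]

/-- The joint law of two linear forms in a standard Gaussian vector depends only on the Gram matrix
of the two forms. -/
lemma map_inner_pair_stdGaussian_congr {p q : E} {p' q' : F} (hp : ‖p‖ = ‖p'‖) (hq : ‖q‖ = ‖q'‖)
    (hpq : inner ℝ p q = inner ℝ p' q') :
    (stdGaussian E).map (fun x => (inner ℝ p x, inner ℝ q x)) =
      (stdGaussian F).map (fun x => (inner ℝ p' x, inner ℝ q' x)) := by
  let S : E →L[ℝ] ℝ × ℝ := (innerSL ℝ p).prod (innerSL ℝ q)
  let T : F →L[ℝ] ℝ × ℝ := (innerSL ℝ p').prod (innerSL ℝ q')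
  change (stdGaussian E).map S = (stdGaussian F).map T
  apply Measure.ext_of_charFunDual
  ext L
  rw [charFunDual_map, charFunDual_map, charFunDual_stdGaussian, charFunDual_stdGaussian]
  have hE : L.comp S = innerSL ℝ (L (1, 0) • p + L (0, 1) • q) := by
    ext x
    have : S x = inner ℝ p x • ((1 : ℝ), (0 : ℝ)) + inner ℝ q x • ((0 : ℝ), (1 : ℝ)) := by
      simp [S]
    rw [ContinuousLinearMap.comp_apply, this, map_add, map_smul, map_smul]
    simp [mul_comm]
  have hF : L.comp T = innerSL ℝ (L (1, 0) • p' + L (0, 1) • q') := by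
    ext x
    have : T x = inner ℝ p' x • ((1 : ℝ), (0 : ℝ)) + inner ℝ q' x • ((0 : ℝ), (1 : ℝ)) := by
      simp [T]
    rw [ContinuousLinearMap.comp_apply, this, map_add, map_smul, map_smul]
    simp [mul_comm]
  rw [hE, hF, innerSL_apply_norm, innerSL_apply_norm]
  have : ‖L (1, 0) • p + L (0, 1) • q‖ ^ 2 = ‖L (1, 0) • p' + L (0, 1) • q'‖ ^ 2 := by
    rw [norm_add_sq_real, norm_add_sq_real, inner_smul_left, inner_smul_right, inner_smul_left,
      inner_smul_right, norm_smul, norm_smul, norm_smul, norm_smul, hp, hq, hpq]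
  rw [← Complex.ofReal_pow, ← Complex.ofReal_pow, this]

lemma integral_cos_pos_mul_cos_pos {θ : ℝ} (h0 : 0 ≤ θ) (hπ : θ ≤ Real.pi) :
    ∫ t in Set.Ioo (-Real.pi) Real.pi, max (Real.cos t) 0 * max (Real.cos (t - θ)) 0 =
      Real.pi / 2 * reluKernel (Real.cos θ) := by
  have hpi := Real.pi_pos
  have hcont : Continuous fun t => max (Real.cos t) 0 * max (Real.cos (t - θ)) 0 := by fun_prop
  have hI : ∀ a b : ℝ, IntervalIntegrable
    (fun t => max (Real.cos t) 0 * max (Real.cos (t - θ)) 0) volume a b :=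
    fun a b => hcont.intervalIntegrable a b
  rw [← integral_Ioc_eq_integral_Ioo, ← intervalIntegral.integral_of_le (by linarith),
    ← intervalIntegral.integral_add_adjacent_intervals (hI (-Real.pi) (θ - Real.pi / 2)) (hI _ _),
    ← intervalIntegral.integral_add_adjacent_intervals
      (hI (θ - Real.pi / 2) (Real.pi / 2)) (hI _ _)]
  have e1 : ∫ t in (-Real.pi)..(θ - Real.pi / 2),
      max (Real.cos t) 0 * max (Real.cos (t - θ)) 0 = 0 := by
    rw [intervalIntegral.integral_congr (g := fun _ => 0)]
    · simp
    · intro t ht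
      rw [Set.uIcc_of_le (by linarith)] at ht
      change max (Real.cos t) 0 * max (Real.cos (t - θ)) 0 = 0
      rcases le_total t (-(Real.pi / 2)) with h | h
      · have : Real.cos t ≤ 0 := by
          rw [← Real.cos_neg]
          exact Real.cos_nonpos_of_pi_div_two_le_of_le (by linarith) (by linarith [ht.1])
        rw [max_eq_right this, zero_mul]
      · have : Real.cos (t - θ) ≤ 0 := by
          rw [← Real.cos_neg]
          exact Real.cos_nonpos_of_pi_div_two_le_of_le (by linarith [ht.2]) (by linarith)
        rw [max_eq_right this, mul_zero]
  have e3 : ∫ t in (Real.pi / 2)..Real.pi,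
      max (Real.cos t) 0 * max (Real.cos (t - θ)) 0 = 0 := by
    rw [intervalIntegral.integral_congr (g := fun _ => 0)]
    · simp
    · intro t ht
      rw [Set.uIcc_of_le (by linarith)] at ht
      change max (Real.cos t) 0 * max (Real.cos (t - θ)) 0 = 0
      have : Real.cos t ≤ 0 :=
        Real.cos_nonpos_of_pi_div_two_le_of_le ht.1 (by linarith [ht.2])
      rw [max_eq_right this, zero_mul]
  have e2 : ∫ t in (θ - Real.pi / 2)..(Real.pi / 2),
      max (Real.cos t) 0 * max (Real.cos (t - θ)) 0 =
      ∫ t in (θ - Real.pi / 2)..(Real.pi / 2),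
        (Real.cos θ / 2 + Real.cos (2 * t - θ) / 2) := by
    apply intervalIntegral.integral_congr
    intro t ht
    rw [Set.uIcc_of_le (by linarith)] at ht
    have h1 : 0 ≤ Real.cos t := Real.cos_nonneg_of_mem_Icc ⟨by linarith [ht.1], ht.2⟩
    have h2 : 0 ≤ Real.cos (t - θ) :=
      Real.cos_nonneg_of_mem_Icc ⟨by linarith [ht.1], by linarith [ht.2]⟩
    change max (Real.cos t) 0 * max (Real.cos (t - θ)) 0 = Real.cos θ / 2 + Real.cos (2 * t - θ) / 2
    rw [max_eq_left h1, max_eq_left h2]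
    have a1 : Real.cos θ = Real.cos (t - (t - θ)) := by congr 1; ring
    have a2 : Real.cos (2 * t - θ) = Real.cos (t + (t - θ)) := by congr 1; ring
    rw [Real.cos_sub] at a1
    rw [Real.cos_add] at a2
    linear_combination (-1 / 2) * a1 + (-1 / 2) * a2
  have e4 : ∫ t in (θ - Real.pi / 2)..(Real.pi / 2),
        (Real.cos θ / 2 + Real.cos (2 * t - θ) / 2) =
      (Real.pi - θ) * Real.cos θ / 2 + Real.sin θ / 2 := by
    have hd : ∀ t ∈ Set.uIcc (θ - Real.pi / 2) (Real.pi / 2), HasDerivAt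
        (fun t => t * (Real.cos θ / 2) + Real.sin (2 * t - θ) / 4)
        (Real.cos θ / 2 + Real.cos (2 * t - θ) / 2) t := by
      intro t _
      have h1 : HasDerivAt (fun t : ℝ => 2 * t - θ) 2 t := by
        simpa using ((hasDerivAt_id t).const_mul 2).sub_const θ
      have h2 := (h1.sin.div_const 4)
      have h3 := (hasDerivAt_id t).mul_const (Real.cos θ / 2)
      refine (h3.add h2).congr_deriv ?_
      ring
    rw [intervalIntegral.integral_eq_sub_of_hasDerivAt hd (by
      apply Continuous.intervalIntegrable; fun_prop)]
    have s1 : Real.sin (2 * (Real.pi / 2) - θ) = Real.sin θ := by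
      rw [← Real.sin_pi_sub]; congr 1; ring
    have s2 : Real.sin (2 * (θ - Real.pi / 2) - θ) = - Real.sin θ := by
      rw [← Real.sin_sub_pi]; congr 1; ring
    rw [s1, s2]; ring
  rw [e1, e2, e3, e4, reluKernel_cos h0 hπ]
  field_simp
  ring

lemma integral_cube_mul_exp_neg_half_sq :
    ∫ x in Set.Ioi (0 : ℝ), x ^ 3 * Real.exp (-x ^ 2 / 2) = 2 := by
  have := integral_rpow_mul_exp_neg_mul_rpow (p := 2) (q := 3) (b := 1 / 2) (by norm_num)
    (by norm_num) (by norm_num)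
  have h2 : (1 / 2 : ℝ) ^ (-(3 + 1) / 2 : ℝ) * (1 / 2) * Real.Gamma ((3 + 1) / 2) = 2 := by
    rw [show (-(3 + 1) / 2 : ℝ) = -((2 : ℕ) : ℝ) by norm_num,
      show ((3 + 1) / 2 : ℝ) = 2 by norm_num, Real.Gamma_two, Real.rpow_neg (by norm_num),
      Real.rpow_natCast]
    norm_num
  rw [h2] at this
  refine Eq.trans (setIntegral_congr_fun measurableSet_Ioi fun x _ => ?_) this
  simp only [show (3 : ℝ) = ((3 : ℕ) : ℝ) by norm_num, show (2 : ℝ) = ((2 : ℕ) : ℝ) by norm_num,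
    Real.rpow_natCast]
  congr 2
  push_cast
  ring

/-- The expectation in the plane, for one vector on the first axis and both of unit length, in polar
coordinates. -/
lemma integral_relu_mul_relu_prod {θ : ℝ} (h0 : 0 ≤ θ) (hπ : θ ≤ Real.pi) :
    ∫ z : ℝ × ℝ, max z.1 0 * max (Real.cos θ * z.1 + Real.sin θ * z.2) 0
        ∂((gaussianReal 0 1).prod (gaussianReal 0 1)) =
      reluKernel (Real.cos θ) / 2 := by
  have hpi := Real.pi_pos
  rw [gaussianReal_of_var_ne_zero 0 one_ne_zero,
    prod_withDensity (measurable_gaussianPDF 0 1) (measurable_gaussianPDF 0 1),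
    integral_withDensity_eq_integral_toReal_smul
      (f := fun z : ℝ × ℝ => gaussianPDF 0 1 z.1 * gaussianPDF 0 1 z.2)
      (((measurable_gaussianPDF 0 1).comp measurable_fst).mul
        ((measurable_gaussianPDF 0 1).comp measurable_snd))
      (Filter.Eventually.of_forall fun z =>
        ENNReal.mul_lt_top gaussianPDF_lt_top gaussianPDF_lt_top),
    ← Measure.volume_eq_prod, ← integral_comp_polarCoord_symm, polarCoord_target]
  have hpt : ∀ z ∈ Set.Ioi (0 : ℝ) ×ˢ Set.Ioo (-Real.pi) Real.pi,
      z.1 • ((gaussianPDF 0 1 (polarCoord.symm z).1 *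
        gaussianPDF 0 1 (polarCoord.symm z).2).toReal •
        (max (polarCoord.symm z).1 0 *
          max (Real.cos θ * (polarCoord.symm z).1 + Real.sin θ * (polarCoord.symm z).2) 0)) =
      ((2 * Real.pi)⁻¹ * (z.1 ^ 3 * Real.exp (-z.1 ^ 2 / 2))) *
        (max (Real.cos z.2) 0 * max (Real.cos (z.2 - θ)) 0) := by
    rintro ⟨ρ, t⟩ ⟨hρ, _⟩
    have hρ : 0 < ρ := hρ
    simp only [polarCoord_symm_apply, ENNReal.toReal_mul, toReal_gaussianPDF, gaussianPDFReal,
      smul_eq_mul, NNReal.coe_one, mul_one, sub_zero]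
    have m1 : max (ρ * Real.cos t) 0 = ρ * max (Real.cos t) 0 := by
      rw [mul_max_of_nonneg _ _ hρ.le, mul_zero]
    have m2 : max (Real.cos θ * (ρ * Real.cos t) + Real.sin θ * (ρ * Real.sin t)) 0 =
        ρ * max (Real.cos (t - θ)) 0 := by
      rw [mul_max_of_nonneg _ _ hρ.le, mul_zero, Real.cos_sub]; congr 1; ring
    have m3 : Real.exp (-ρ ^ 2 / 2) =
        Real.exp (-(ρ * Real.cos t) ^ 2 / 2) * Real.exp (-(ρ * Real.sin t) ^ 2 / 2) := by
      rw [← Real.exp_add]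
      congr 1
      have := Real.sin_sq_add_cos_sq t
      linear_combination (ρ ^ 2 / 2) * this
    have m4 : (√(2 * Real.pi))⁻¹ * (√(2 * Real.pi))⁻¹ = (2 * Real.pi)⁻¹ := by
      rw [← mul_inv, Real.mul_self_sqrt (by positivity)]
    rw [m1, m2, m3, ← m4]
    ring
  rw [setIntegral_congr_fun (measurableSet_Ioi.prod measurableSet_Ioo) hpt,
    Measure.volume_eq_prod, setIntegral_prod_mul
      (fun x : ℝ => (2 * Real.pi)⁻¹ * (x ^ 3 * Real.exp (-x ^ 2 / 2)))
      (fun t : ℝ => max (Real.cos t) 0 * max (Real.cos (t - θ)) 0),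
    integral_cos_pos_mul_cos_pos h0 hπ, integral_const_mul, integral_cube_mul_exp_neg_half_sq]
  field_simp

/-- The product of two rectified linear forms in a standard Gaussian vector has expectation
`‖p‖ ‖q‖ k(cos ∠(p, q)) / 2`, where `k` is the arc-cosine kernel. -/
lemma integral_relu_inner_mul_relu_inner (p q : E) :
    ∫ x, max (inner ℝ p x) 0 * max (inner ℝ q x) 0 ∂(stdGaussian E) =
      ‖p‖ * ‖q‖ * reluKernel (inner ℝ p q / (‖p‖ * ‖q‖)) / 2 := by
  set θ := InnerProductGeometry.angle p q with hθ
  have h0 : 0 ≤ θ := InnerProductGeometry.angle_nonneg p q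
  have hπ : θ ≤ Real.pi := InnerProductGeometry.angle_le_pi p q
  let p' : EuclideanSpace ℝ (Fin 2) := !₂[‖p‖, 0]
  let q' : EuclideanSpace ℝ (Fin 2) := !₂[‖q‖ * Real.cos θ, ‖q‖ * Real.sin θ]
  have hp : ‖p‖ = ‖p'‖ := by simp [p', EuclideanSpace.norm_eq]
  have hq : ‖q‖ = ‖q'‖ := by
    simp only [q', EuclideanSpace.norm_eq, Fin.sum_univ_two, Real.norm_eq_abs, sq_abs]
    rw [← Real.sqrt_sq (norm_nonneg q)]
    congr 1
    simp only [Real.sqrt_sq (norm_nonneg q)]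
    have := Real.sin_sq_add_cos_sq θ
    simp
    linear_combination (-‖q‖ ^ 2) * this
  have hpq : inner ℝ p q = inner ℝ p' q' := by
    rw [← InnerProductGeometry.cos_angle_mul_norm_mul_norm]
    simp [p', q', PiLp.inner_apply, Fin.sum_univ_two]
    ring
  have hmeas : AEStronglyMeasurable (fun z : ℝ × ℝ => max z.1 0 * max z.2 0)
      ((stdGaussian E).map (fun x => (inner ℝ p x, inner ℝ q x))) := by
    apply Continuous.aestronglyMeasurable; fun_prop
  rw [← integral_map (f := fun z : ℝ × ℝ => max z.1 0 * max z.2 0)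
      (φ := fun x : E => (inner ℝ p x, inner ℝ q x))
      (by apply Continuous.aemeasurable; fun_prop) hmeas,
    map_inner_pair_stdGaussian_congr hp hq hpq,
    integral_map (by apply Continuous.aemeasurable; fun_prop)
      (by apply Continuous.aestronglyMeasurable; fun_prop),
    ← map_pi_eq_stdGaussian,
    integral_map (by apply Measurable.aemeasurable; fun_prop)
      (by apply Continuous.aestronglyMeasurable; fun_prop)]
  have hcomp := (measurePreserving_finTwoArrow (gaussianReal 0 1)).integral_comp
    (MeasurableEquiv.measurableEmbedding _)
    (fun z : ℝ × ℝ => ‖p‖ * ‖q‖ * (max z.1 0 * max (Real.cos θ * z.1 + Real.sin θ * z.2) 0))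
  rw [integral_const_mul (μ := (gaussianReal 0 1).prod (gaussianReal 0 1)),
    integral_relu_mul_relu_prod h0 hπ] at hcomp
  have hcos : ‖p‖ * ‖q‖ * reluKernel (inner ℝ p q / (‖p‖ * ‖q‖)) =
      ‖p‖ * ‖q‖ * reluKernel (Real.cos θ) := by
    rw [hθ, InnerProductGeometry.cos_angle]
  rw [hcos, mul_div_assoc, ← hcomp]
  refine integral_congr_ae (Filter.Eventually.of_forall fun x => ?_)
  have i1 : inner ℝ p' (WithLp.toLp 2 x) = ‖p‖ * x 0 := by
    simp [p', PiLp.inner_apply, Fin.sum_univ_two, mul_comm]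
  have i2 : inner ℝ q' (WithLp.toLp 2 x) = ‖q‖ * (Real.cos θ * x 0 + Real.sin θ * x 1) := by
    simp [q', PiLp.inner_apply, Fin.sum_univ_two]; ring
  simp only [i1, i2, MeasurableEquiv.finTwoArrow_apply]
  have m1 : max (‖p‖ * x 0) 0 = ‖p‖ * max (x 0) 0 := by
    rw [mul_max_of_nonneg _ _ (norm_nonneg p), mul_zero]
  have m2 : max (‖q‖ * (Real.cos θ * x 0 + Real.sin θ * x 1)) 0 =
      ‖q‖ * max (Real.cos θ * x 0 + Real.sin θ * x 1) 0 := by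
    rw [mul_max_of_nonneg _ _ (norm_nonneg q), mul_zero]
  rw [m1, m2]; ring

lemma memLp_relu_inner (p : E) :
    MemLp (fun x => max (inner ℝ p x) 0) 2 (stdGaussian E) :=
  MemLp.pos_part (IsGaussian.memLp_dual (stdGaussian E) (innerSL ℝ p) 2 (by simp))

/-- Expected squared distance between the outputs of two neurons on a standard Gaussian input. -/
lemma integral_relu_sub_relu_sq (p q : E) :
    ∫ x, (relu (inner ℝ p x) - relu (inner ℝ q x)) ^ 2 ∂(stdGaussian E) =
      ‖p‖ ^ 2 + ‖q‖ ^ 2 - 2 * (‖p‖ * ‖q‖ * reluKernel (inner ℝ p q / (‖p‖ * ‖q‖))) := by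
  have hI : ∀ p q : E, Integrable (fun x => max (inner ℝ p x) 0 * max (inner ℝ q x) 0)
      (stdGaussian E) := fun p q => (memLp_relu_inner p).integrable_mul (memLp_relu_inner q)
  have hself : ∀ p : E, ‖p‖ * ‖p‖ * reluKernel (inner ℝ p p / (‖p‖ * ‖p‖)) = ‖p‖ ^ 2 := by
    intro p
    rcases eq_or_ne p 0 with rfl | hp
    · simp
    · rw [real_inner_self_eq_norm_mul_norm, div_self (by simpa using hp), reluKernel_one]; ring
  have hexp : ∀ x, (relu (inner ℝ p x) - relu (inner ℝ q x)) ^ 2 =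
      2 * (max (inner ℝ p x) 0 * max (inner ℝ p x) 0) +
        2 * (max (inner ℝ q x) 0 * max (inner ℝ q x) 0) -
        4 * (max (inner ℝ p x) 0 * max (inner ℝ q x) 0) := by
    intro x
    have := Real.sq_sqrt (show (0 : ℝ) ≤ 2 by norm_num)
    simp only [relu]
    linear_combination (max (inner ℝ p x) 0 - max (inner ℝ q x) 0) ^ 2 * this
  simp_rw [hexp]
  have hadd : Integrable (fun x => 2 * (max (inner ℝ p x) 0 * max (inner ℝ p x) 0) +
      2 * (max (inner ℝ q x) 0 * max (inner ℝ q x) 0)) (stdGaussian E) :=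
    ((hI p p).const_mul 2).add ((hI q q).const_mul 2)
  rw [integral_sub hadd ((hI p q).const_mul 4),
    integral_add ((hI p p).const_mul 2) ((hI q q).const_mul 2),
    integral_const_mul, integral_const_mul, integral_const_mul,
    integral_relu_inner_mul_relu_inner, integral_relu_inner_mul_relu_inner,
    integral_relu_inner_mul_relu_inner, hself, hself]
  ring

lemma integrable_relu_sub_relu_sq (p q : E) :
    Integrable (fun x => (relu (inner ℝ p x) - relu (inner ℝ q x)) ^ 2) (stdGaussian E) := by
  have h := ((memLp_relu_inner p).const_mul √2).sub ((memLp_relu_inner q).const_mul √2)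
  exact h.integrable_sq

end Gaussian

/-! ### Closed form of the training risk -/

/-- The feature matrix, read as one long vector, is a standard Gaussian vector. -/
lemma map_featureLaw (n r : ℕ) :
    (featureLaw n r).map (fun X => WithLp.toLp 2 (fun kl : Fin n × Fin r => X kl.1 kl.2)) =
      stdGaussian (EuclideanSpace ℝ (Fin n × Fin r)) := by
  have hm : Measurable (fun X : Fin n → Fin r → ℝ =>
      (WithLp.toLp 2 (fun kl : Fin n × Fin r => X kl.1 kl.2) :
        EuclideanSpace ℝ (Fin n × Fin r))) := by
    fun_prop
  have : IsProbabilityMeasure (featureLaw n r) := by unfold featureLaw; infer_instance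
  have := Measure.isProbabilityMeasure_map (μ := featureLaw n r) hm.aemeasurable
  apply Measure.ext_of_charFun
  ext t
  rw [charFun_apply,
    integral_map hm.aemeasurable (by apply Continuous.aestronglyMeasurable; fun_prop),
    charFun_stdGaussian]
  have hexp : ∀ X : Fin n → Fin r → ℝ,
      Complex.exp ((inner ℝ (WithLp.toLp 2 (fun kl : Fin n × Fin r => X kl.1 kl.2)) t : ℝ) *
        Complex.I) = ∏ k, ∏ l, Complex.exp (t (k, l) * X k l * Complex.I) := by
    intro X
    simp_rw [← Complex.exp_sum, PiLp.inner_apply, Fintype.sum_prod_type]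
    simp [Finset.sum_mul]
  simp_rw [hexp, featureLaw]
  rw [integral_fintype_prod_eq_prod (𝕜 := ℂ) (fun k (x : Fin r → ℝ) =>
    ∏ l, Complex.exp (t (k, l) * x l * Complex.I))]
  have hrow : ∀ k, ∫ x : Fin r → ℝ, ∏ l, Complex.exp (t (k, l) * x l * Complex.I)
      ∂(Measure.pi fun _ => gaussianReal 0 1) = ∏ l, Complex.exp (-(t (k, l)) ^ 2 / 2) := by
    intro k
    rw [integral_fintype_prod_eq_prod (𝕜 := ℂ) (fun l (x : ℝ) =>
      Complex.exp (t (k, l) * x * Complex.I))]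
    refine Finset.prod_congr rfl fun l _ => ?_
    rw [← charFun_apply_real, charFun_gaussianReal]
    congr 1
    simp
    ring
  simp_rw [hrow, ← Complex.exp_sum]
  congr 1
  rw [← Complex.ofReal_pow, EuclideanSpace.norm_sq_eq, Fintype.sum_prod_type]
  push_cast
  simp [Finset.sum_div, neg_div, ← Complex.ofReal_pow]

/-- Expected squared distance between the outputs of a neuron with weights `w` and one with weights
`v`, on a standard Gaussian input. -/
noncomputable def neuronLoss {E : Type*} [NormedAddCommGroup E] [InnerProductSpace ℝ E]
    (v w : E) : ℝ :=
  ‖w‖ ^ 2 + ‖v‖ ^ 2 - 2 * (‖w‖ * ‖v‖ * reluKernel (inner ℝ w v / (‖w‖ * ‖v‖)))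

/-- Row `j` of a parameter vector, as a continuous linear map. -/
noncomputable def rowL (h r : ℕ) (j : Fin h) : Params h r →L[ℝ] EuclideanSpace ℝ (Fin r) :=
  LinearMap.toContinuousLinearMap
    { toFun := fun W => WithLp.toLp 2 fun l => W (j, l)
      map_add' := fun _ _ => rfl
      map_smul' := fun _ _ => rfl }

@[simp] lemma rowL_apply {h r : ℕ} (j : Fin h) (W : Params h r) (l : Fin r) :
    rowL h r j W l = W (j, l) := rfl

/-- Average squared Euclidean norm of the rows of a matrix. -/
noncomputable def meanRowSq {n : ℕ} {train : Finset (Fin n)} (A : Matrix train (Fin n) ℝ) : ℝ :=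
  (train.card : ℝ)⁻¹ * ∑ i, ∑ k, A i k ^ 2

lemma norm_sq_toLp_mul {α β : Type*} [Fintype α] [Fintype β] (a : α → ℝ) (w : β → ℝ) :
    ‖(WithLp.toLp 2 fun kl : α × β => a kl.1 * w kl.2 : EuclideanSpace ℝ (α × β))‖ ^ 2 =
      (∑ k, a k ^ 2) * ∑ l, w l ^ 2 := by
  rw [EuclideanSpace.norm_sq_eq, Fintype.sum_prod_type, Finset.sum_mul_sum]
  simp [mul_pow]

lemma norm_toLp_mul {α β : Type*} [Fintype α] [Fintype β] (a : α → ℝ) (w : EuclideanSpace ℝ β) :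
    ‖(WithLp.toLp 2 fun kl : α × β => a kl.1 * w kl.2 : EuclideanSpace ℝ (α × β))‖ =
      √(∑ k, a k ^ 2) * ‖w‖ := by
  have h := norm_sq_toLp_mul a w
  have hw : ∑ l, w l ^ 2 = ‖w‖ ^ 2 := by simp [EuclideanSpace.norm_sq_eq]
  rw [hw] at h
  rw [← Real.sqrt_sq (norm_nonneg (WithLp.toLp 2 _)), h, Real.sqrt_mul (by positivity),
    Real.sqrt_sq (norm_nonneg w)]

lemma inner_toLp_mul {α β : Type*} [Fintype α] [Fintype β] (a : α → ℝ)
    (w v : EuclideanSpace ℝ β) :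
    inner ℝ (WithLp.toLp 2 fun kl : α × β => a kl.1 * w kl.2 : EuclideanSpace ℝ (α × β))
      (WithLp.toLp 2 fun kl : α × β => a kl.1 * v kl.2) = (∑ k, a k ^ 2) * inner ℝ w v := by
  simp only [PiLp.inner_apply, Fintype.sum_prod_type, Finset.sum_mul_sum]
  refine Finset.sum_congr rfl fun k _ => Finset.sum_congr rfl fun l _ => ?_
  simp
  ring

/-- The expected risk splits over neurons, and each neuron sees an isotropic Gaussian input whose
variance is the squared norm of a row of the propagation matrix. -/
lemma trainRisk_eq {n r h : ℕ} {train : Finset (Fin n)} (A : Matrix train (Fin n) ℝ)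
    (Wstar : Matrix (Fin h) (Fin r) ℝ) (W : Params h r) :
    trainRisk A Wstar W =
      meanRowSq A / 2 * ∑ j, neuronLoss (WithLp.toLp 2 (Wstar j)) (rowL h r j W) := by
  let p : (train) → EuclideanSpace ℝ (Fin r) → EuclideanSpace ℝ (Fin n × Fin r) :=
    fun i w => WithLp.toLp 2 fun kl => A i kl.1 * w kl.2
  let Φ : (Fin n → Fin r → ℝ) → EuclideanSpace ℝ (Fin n × Fin r) :=
    fun X => WithLp.toLp 2 (fun kl : Fin n × Fin r => X kl.1 kl.2)
  have hΦ : Measurable Φ := by fun_prop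
  have hout : ∀ (i : train) (w : EuclideanSpace ℝ (Fin r)) (X : Fin n → Fin r → ℝ),
      ∑ l, (∑ k, A i k * X k l) * w l = inner ℝ (p i w) (Φ X) := by
    intro i w X
    simp only [p, Φ, PiLp.inner_apply, Fintype.sum_prod_type]
    rw [Finset.sum_comm]
    refine Finset.sum_congr rfl fun l _ => ?_
    rw [Finset.sum_mul]
    refine Finset.sum_congr rfl fun k _ => ?_
    simp
    ring
  have hint : ∀ X : Fin n → Fin r → ℝ, empiricalRisk A Wstar W.toMatrix (Matrix.of X) =
      (fun Y => (train.card : ℝ)⁻¹ * ∑ i : train, (1 / 2 : ℝ) * ∑ j : Fin h,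
        (relu (inner ℝ (p i (rowL h r j W)) Y) -
          relu (inner ℝ (p i (WithLp.toLp 2 (Wstar j))) Y)) ^ 2) (Φ X) := by
    intro X
    simp only [empiricalRisk, gnnOutput, Matrix.map_apply, Matrix.mul_apply, Matrix.transpose_apply,
      Params.toMatrix, Matrix.of_apply, ← hout]
    rfl
  unfold trainRisk
  simp_rw [hint]
  rw [← integral_map (f := fun Y : EuclideanSpace ℝ (Fin n × Fin r) =>
      (train.card : ℝ)⁻¹ * ∑ i : train, (1 / 2 : ℝ) * ∑ j : Fin h,
        (relu (inner ℝ (p i (rowL h r j W)) Y) -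
          relu (inner ℝ (p i (WithLp.toLp 2 (Wstar j))) Y)) ^ 2) hΦ.aemeasurable
      (by apply Continuous.aestronglyMeasurable; unfold relu; fun_prop), map_featureLaw,
    integral_const_mul, integral_finsetSum _ (fun i _ => Integrable.const_mul
      (integrable_finsetSum _ fun j _ => integrable_relu_sub_relu_sq _ _) _)]
  have hi : ∀ i : train, ∫ Y, (1 / 2 : ℝ) * ∑ j : Fin h,
        (relu (inner ℝ (p i (rowL h r j W)) Y) -
          relu (inner ℝ (p i (WithLp.toLp 2 (Wstar j))) Y)) ^ 2
        ∂(stdGaussian (EuclideanSpace ℝ (Fin n × Fin r))) =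
      (∑ k, A i k ^ 2) * ((1 / 2) *
        ∑ j, neuronLoss (WithLp.toLp 2 (Wstar j)) (rowL h r j W)) := by
    intro i
    rw [integral_const_mul, integral_finsetSum _ fun j _ => integrable_relu_sub_relu_sq _ _,
      mul_left_comm]
    congr 1
    rw [Finset.mul_sum]
    refine Finset.sum_congr rfl fun j _ => ?_
    rw [integral_relu_sub_relu_sq, norm_toLp_mul, norm_toLp_mul, inner_toLp_mul, neuronLoss]
    set s := ∑ k, A i k ^ 2
    have hs0 : 0 ≤ s := Finset.sum_nonneg fun k _ => sq_nonneg _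
    have hs := Real.mul_self_sqrt hs0
    generalize rowL h r j W = w
    generalize (WithLp.toLp 2 (Wstar j) : EuclideanSpace ℝ (Fin r)) = v
    rcases hs0.eq_or_lt with h0 | h0
    · rw [← h0]; simp
    · have : s * inner ℝ w v / (√s * ‖w‖ * (√s * ‖v‖)) = inner ℝ w v / (‖w‖ * ‖v‖) := by
        rw [show √s * ‖w‖ * (√s * ‖v‖) = (√s * √s) * (‖w‖ * ‖v‖) by ring, hs,
          mul_div_mul_left _ _ h0.ne']
      rw [this]
      linear_combination (‖w‖ ^ 2 + ‖v‖ ^ 2 -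
        2 * (‖w‖ * ‖v‖ * reluKernel (inner ℝ w v / (‖w‖ * ‖v‖)))) * hs
  simp_rw [hi]
  rw [← Finset.sum_mul, meanRowSq]
  ring

/-! ### Gradient of the risk -/

section Gradient

variable {E : Type*} [NormedAddCommGroup E] [InnerProductSpace ℝ E]

/-- Sine of the angle between `w` and a unit vector `v`, divided by `‖w‖`. -/
noncomputable def sinRatio (v w : E) : ℝ :=
  √(1 - (inner ℝ w v / ‖w‖) ^ 2) / ‖w‖

/-- The direction in which one neuron is pushed at `w`: half the gradient of `neuronLoss v`
is `w` minus this vector. -/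
noncomputable def pull (v w : E) : E :=
  (sinRatio v w / Real.pi) • w +
    ((Real.pi - Real.arccos (inner ℝ w v / ‖w‖)) / Real.pi) • v

lemma hasFDerivAt_neuronLoss {v w : E} (hv : ‖v‖ = 1) (hw : w ≠ 0) :
    HasFDerivAt (neuronLoss v) (innerSL ℝ ((2 : ℝ) • (w - pull v w))) w := by
  have hn : ‖w‖ ≠ 0 := norm_ne_zero_iff.mpr hw
  have hsq : HasFDerivAt (fun x : E => ‖x‖ ^ 2) (2 • innerSL ℝ w) w :=
    (hasStrictFDerivAt_norm_sq w).hasFDerivAt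
  have hnorm : HasFDerivAt (fun x : E => ‖x‖) (‖w‖⁻¹ • innerSL ℝ w) w := by
    have := hsq.sqrt (pow_ne_zero 2 hn)
    simp only [Real.sqrt_sq (norm_nonneg _)] at this
    refine this.congr_fderiv ?_
    ext x
    simp
    field_simp
  have hin : HasFDerivAt (fun x : E => inner ℝ x v) (innerSL ℝ v) w := by
    have := (innerSL ℝ v).hasFDerivAt (x := w)
    refine this.congr_of_eventuallyEq (Filter.Eventually.of_forall fun x => ?_)
    simp [real_inner_comm]
  have hinv : HasFDerivAt (fun x : E => ‖x‖⁻¹) (-(‖w‖ ^ 2)⁻¹ • (‖w‖⁻¹ • innerSL ℝ w)) w :=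
    (hasDerivAt_inv hn).comp_hasFDerivAt w hnorm
  have hc := hin.mul hinv
  have hK := (hasDerivAt_reluKernel (inner ℝ w v * ‖w‖⁻¹)).comp_hasFDerivAt w hc
  have htot := (hsq.add_const (‖v‖ ^ 2)).sub ((hnorm.mul hK).const_mul 2)
  have heq : neuronLoss v = fun x => ‖x‖ ^ 2 + ‖v‖ ^ 2 -
      2 * (‖x‖ * (reluKernel ∘ fun x => inner ℝ x v * ‖x‖⁻¹) x) := by
    funext x
    simp [neuronLoss, hv, div_eq_mul_inv]
  rw [heq]
  refine htot.congr_fderiv ?_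
  ext x
  simp [pull, sinRatio, reluKernel, div_eq_mul_inv, real_inner_comm]
  field_simp
  ring

end Gradient

lemma hasGradientAt_trainRisk {n r h : ℕ} {train : Finset (Fin n)} (A : Matrix train (Fin n) ℝ)
    {Wstar : Matrix (Fin h) (Fin r) ℝ}
    (hstar : ∀ j, ‖(WithLp.toLp 2 (Wstar j) : EuclideanSpace ℝ (Fin r))‖ = 1)
    {W : Params h r} (hW : ∀ j, rowL h r j W ≠ 0) :
    HasGradientAt (trainRisk A Wstar) (meanRowSq A • WithLp.toLp 2 fun jl : Fin h × Fin r =>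
      (rowL h r jl.1 W - pull (WithLp.toLp 2 (Wstar jl.1)) (rowL h r jl.1 W)) jl.2) W := by
  rw [hasGradientAt_iff_hasFDerivAt]
  have h1 : ∀ j ∈ Finset.univ, HasFDerivAt
      (fun W => neuronLoss (WithLp.toLp 2 (Wstar j)) (rowL h r j W)) _ W := fun j _ =>
    (hasFDerivAt_neuronLoss (hstar j) (hW j)).comp W (rowL h r j).hasFDerivAt
  have h2 := (HasFDerivAt.fun_sum h1).const_mul (meanRowSq A / 2)
  rw [funext (trainRisk_eq A Wstar)]
  refine h2.congr_fderiv ?_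
  ext Δ
  simp only [smul_apply, sum_apply,
    ContinuousLinearMap.comp_apply, innerSL_apply_apply, InnerProductSpace.toDual_apply_apply,
    inner_smul_left]
  simp only [PiLp.inner_apply, Fintype.sum_prod_type, rowL_apply]
  simp [Finset.mul_sum]
  refine Finset.sum_congr rfl fun j _ => Finset.sum_congr rfl fun l _ => ?_
  ring

lemma rowL_gradient_trainRisk {n r h : ℕ} {train : Finset (Fin n)} (A : Matrix train (Fin n) ℝ)
    {Wstar : Matrix (Fin h) (Fin r) ℝ}
    (hstar : ∀ j, ‖(WithLp.toLp 2 (Wstar j) : EuclideanSpace ℝ (Fin r))‖ = 1)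
    {W : Params h r} (hW : ∀ j, rowL h r j W ≠ 0) (j : Fin h) :
    rowL h r j (gradient (trainRisk A Wstar) W) =
      meanRowSq A • (rowL h r j W - pull (WithLp.toLp 2 (Wstar j)) (rowL h r j W)) := by
  rw [(hasGradientAt_trainRisk A hstar hW).gradient]
  ext l
  simp

/-! ### Dynamics of one neuron in the plane -/

/-- Growth factor of the component orthogonal to the target in one gradient step of size `s`, for a
neuron with coordinates `x` along the target and `y` across it. -/
noncomputable def growth (s x y : ℝ) : ℝ := 1 - s + s / Real.pi * (y / (x ^ 2 + y ^ 2))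

/-- The coordinate along the target after one gradient step of size `s`. -/
noncomputable def nextX (s x y : ℝ) : ℝ :=
  growth s x y * x + s * ((Real.pi - Real.arccos (x / √(x ^ 2 + y ^ 2))) / Real.pi)

/-- The coordinate across the target after one gradient step of size `s`. -/
noncomputable def nextY (s x y : ℝ) : ℝ := growth s x y * y

section Step

variable {s x y : ℝ}

lemma one_sub_le_growth (hs : 0 ≤ s) (hy : 0 ≤ y) : 1 - s ≤ growth s x y := by
  have : 0 ≤ s / Real.pi * (y / (x ^ 2 + y ^ 2)) := by positivity
  unfold growth; linarith

lemma growth_pos (hs : 0 ≤ s) (hs1 : s < 1) (hy : 0 ≤ y) : 0 < growth s x y := by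
  linarith [one_sub_le_growth (x := x) hs hy]

lemma growth_mul_le (hs : 0 ≤ s) (hy : 0 < y) : growth s x y * y ≤ (1 - s) * y + s / 3 := by
  have h1 : y / (x ^ 2 + y ^ 2) * y ≤ 1 := by
    rw [div_mul_eq_mul_div, div_le_one (by positivity)]; nlinarith [sq_nonneg x]
  have h2 : s / Real.pi ≤ s / 3 := by gcongr; exact Real.pi_gt_three.le
  have : s / Real.pi * (y / (x ^ 2 + y ^ 2) * y) ≤ s / 3 * 1 := by gcongr
  unfold growth; linarith

lemma growth_mul_abs_le (hs : 0 ≤ s) (hy : 0 < y) :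
    growth s x y * |x| ≤ (1 - s) * |x| + s / 3 := by
  have h1 : y / (x ^ 2 + y ^ 2) * |x| ≤ 1 := by
    rw [div_mul_eq_mul_div, div_le_one (by positivity)]
    nlinarith [sq_nonneg (|x| - y), sq_abs x, sq_nonneg (|x| + y)]
  have h2 : s / Real.pi ≤ s / 3 := by gcongr; exact Real.pi_gt_three.le
  have : s / Real.pi * (y / (x ^ 2 + y ^ 2) * |x|) ≤ s / 3 * 1 := by gcongr
  unfold growth; linarith

lemma angle_ratio_nonneg (c : ℝ) : 0 ≤ (Real.pi - Real.arccos c) / Real.pi :=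
  div_nonneg (by linarith [Real.arccos_le_pi c]) Real.pi_pos.le

lemma angle_ratio_le_one (c : ℝ) : (Real.pi - Real.arccos c) / Real.pi ≤ 1 := by
  rw [div_le_one Real.pi_pos]; linarith [Real.arccos_nonneg c]

lemma growth_mul_le_nextX (hs : 0 ≤ s) : growth s x y * x ≤ nextX s x y := by
  have := mul_nonneg hs (angle_ratio_nonneg (x / √(x ^ 2 + y ^ 2)))
  unfold nextX; linarith

/-- Once the neuron forms an acute angle with the target, the coordinate along the target is
attracted by `1 / 2`. -/
lemma le_nextX_of_nonneg (hs : 0 ≤ s) (hx : 0 ≤ x) (hy : 0 ≤ y) :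
    (1 - s) * x + s / 2 ≤ nextX s x y := by
  have h1 := mul_le_mul_of_nonneg_right (one_sub_le_growth (x := x) hs hy) hx
  have h2 : (1 : ℝ) / 2 ≤ (Real.pi - Real.arccos (x / √(x ^ 2 + y ^ 2))) / Real.pi := by
    rw [div_le_div_iff₀ (by norm_num) Real.pi_pos]
    have := Real.arccos_le_pi_div_two.mpr (div_nonneg hx (Real.sqrt_nonneg (x ^ 2 + y ^ 2)))
    linarith
  have := mul_le_mul_of_nonneg_left h2 hs
  unfold nextX; linarith

lemma abs_nextX_add_le (hs : 0 ≤ s) (hs1 : s < 1) (hy : 0 < y) :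
    |nextX s x y| + 8 * nextY s x y ≤ (1 - s) * (|x| + 8 * y) + 5 * s := by
  have h1 := growth_mul_abs_le (x := x) hs hy
  have h2 := growth_mul_le (x := x) hs hy
  have h3 := mul_le_mul_of_nonneg_left (angle_ratio_le_one (x / √(x ^ 2 + y ^ 2))) hs
  have h4 := mul_nonneg hs (angle_ratio_nonneg (x / √(x ^ 2 + y ^ 2)))
  have h5 : |nextX s x y| ≤ growth s x y * |x| + s := by
    unfold nextX
    refine (abs_add_le _ _).trans ?_
    rw [abs_mul, abs_of_pos (growth_pos hs hs1 hy.le), abs_of_nonneg h4]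
    linarith
  unfold nextY
  linarith

/-- While the angle with the target is obtuse, the circle through the origin that is tangent to the
target line and passes through the neuron shrinks geometrically to a bounded size. -/
lemma sq_div_next_le (hs : 0 ≤ s) (hs1 : s < 1) (hy : 0 < y) (hx' : nextX s x y ≤ 0) :
    (nextX s x y ^ 2 + nextY s x y ^ 2) / nextY s x y ≤
      (1 - s) * ((x ^ 2 + y ^ 2) / y) + s / 3 := by
  have hg := growth_pos (x := x) hs hs1 hy.le
  have hsq : nextX s x y ^ 2 ≤ (growth s x y * x) ^ 2 := by
    have := growth_mul_le_nextX (x := x) (y := y) hs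
    nlinarith
  have hle : (nextX s x y ^ 2 + nextY s x y ^ 2) / nextY s x y ≤
      growth s x y * ((x ^ 2 + y ^ 2) / y) := by
    rw [nextY, div_le_iff₀ (by positivity)]
    have : growth s x y * ((x ^ 2 + y ^ 2) / y) * (growth s x y * y) =
      (growth s x y * x) ^ 2 + (growth s x y * y) ^ 2 := by field_simp
    linarith
  refine hle.trans ?_
  have : growth s x y * ((x ^ 2 + y ^ 2) / y) =
      (1 - s) * ((x ^ 2 + y ^ 2) / y) + s / Real.pi := by
    have : x ^ 2 + y ^ 2 ≠ 0 := by positivity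
    unfold growth; field_simp
  have h2 : s / Real.pi ≤ s / 3 := by gcongr; exact Real.pi_gt_three.le
  linarith

lemma neg_div_next_eq (hs : 0 ≤ s) (hs1 : s < 1) (hy : 0 < y) :
    -nextX s x y / nextY s x y = -x / y -
      s * ((Real.pi - Real.arccos (x / √(x ^ 2 + y ^ 2))) / Real.pi) / nextY s x y := by
  have hg := growth_pos (x := x) hs hs1 hy.le
  unfold nextX nextY
  field_simp
  ring

lemma neg_div_next_le (hs : 0 ≤ s) (hs1 : s < 1) (hy : 0 < y) :
    -nextX s x y / nextY s x y ≤ -x / y := by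
  rw [neg_div_next_eq hs hs1 hy]
  have hg := growth_pos (x := x) hs hs1 hy.le
  have := angle_ratio_nonneg (x / √(x ^ 2 + y ^ 2))
  have : 0 ≤ s * ((Real.pi - Real.arccos (x / √(x ^ 2 + y ^ 2))) / Real.pi) / nextY s x y := by
    unfold nextY; positivity
  linarith

/-- While the angle with the target is obtuse, the slope of the neuron decreases geometrically as
soon as the tangent circle has bounded size. -/
lemma one_add_neg_div_next_le (hs : 0 ≤ s) (hs1 : s < 1) (hy : 0 < y) (hx : x ≤ 0)
    (hu : (x ^ 2 + y ^ 2) / y ≤ 4 / 3) :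
    1 + -nextX s x y / nextY s x y ≤ (1 - s / 10) * (1 + -x / y) := by
  have hpi := Real.pi_pos
  have hg := growth_pos (x := x) hs hs1 hy.le
  set ρ := √(x ^ 2 + y ^ 2) with hρ
  have hρ2 : ρ ^ 2 = x ^ 2 + y ^ 2 := Real.sq_sqrt (by positivity)
  have hρ0 : 0 < ρ := Real.sqrt_pos.mpr (by positivity)
  -- the angle to the antipode of the target is at least its sine
  have hφ : y / (y - x) ≤ Real.pi - Real.arccos (x / ρ) := by
    have h1 : y / ρ = Real.sin (Real.pi - Real.arccos (x / ρ)) := by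
      rw [Real.sin_pi_sub, Real.sin_arccos]
      have : 1 - (x / ρ) ^ 2 = (y / ρ) ^ 2 := by
        field_simp; linarith
      rw [this, Real.sqrt_sq (by positivity)]
    have h2 : Real.sin (Real.pi - Real.arccos (x / ρ)) ≤ Real.pi - Real.arccos (x / ρ) :=
      Real.sin_le (by linarith [Real.arccos_le_pi (x / ρ)])
    have h3 : y / (y - x) ≤ y / ρ := by
      gcongr
      nlinarith
    linarith
  have hY : nextY s x y ≤ 4 / 3 * (y ^ 2 / (x ^ 2 + y ^ 2)) := by
    have h1 : growth s x y * ((x ^ 2 + y ^ 2) / y) =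
        (1 - s) * ((x ^ 2 + y ^ 2) / y) + s / Real.pi := by
      have : x ^ 2 + y ^ 2 ≠ 0 := by positivity
      unfold growth; field_simp
    have h2 : s / Real.pi ≤ s / 3 := by gcongr; exact Real.pi_gt_three.le
    have h3 : growth s x y * ((x ^ 2 + y ^ 2) / y) ≤ 4 / 3 := by
      have := mul_le_mul_of_nonneg_left hu (show 0 ≤ 1 - s by linarith)
      linarith
    have h4 : nextY s x y =
        growth s x y * ((x ^ 2 + y ^ 2) / y) * (y ^ 2 / (x ^ 2 + y ^ 2)) := by
      have : x ^ 2 + y ^ 2 ≠ 0 := by positivity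
      unfold nextY; field_simp
    rw [h4]
    gcongr
  have hY0 : 0 < nextY s x y := by unfold nextY; positivity
  have hyx : 0 < y - x := by linarith
  have key : 1 / 10 * (1 + -x / y) ≤ (Real.pi - Real.arccos (x / ρ)) / Real.pi / nextY s x y := by
    rw [le_div_iff₀ hY0, le_div_iff₀ hpi]
    have e1 : 1 / 10 * (1 + -x / y) * nextY s x y ≤
        1 / 10 * (1 + -x / y) * (4 / 3 * (y ^ 2 / (x ^ 2 + y ^ 2))) := by
      have : 0 ≤ 1 + -x / y := by have := div_nonneg (neg_nonneg.mpr hx) hy.le; linarith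
      gcongr
    have e2 : 1 / 10 * (1 + -x / y) * (4 / 3 * (y ^ 2 / (x ^ 2 + y ^ 2))) =
        2 / 15 * ((y - x) * y / (x ^ 2 + y ^ 2)) := by
      have : x ^ 2 + y ^ 2 ≠ 0 := by positivity
      field_simp
      ring
    have e3 : 2 / 15 * ((y - x) * y / (x ^ 2 + y ^ 2)) * 3.15 ≤ y / (y - x) := by
      rw [mul_div_assoc', div_mul_eq_mul_div, div_le_div_iff₀ (by positivity) hyx]
      nlinarith [mul_pos hy hyx, mul_nonneg hy.le (sq_nonneg (x + y)),
        mul_nonneg hy.le (sq_nonneg (x - y))]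
    have e4 : 1 / 10 * (1 + -x / y) * nextY s x y * Real.pi ≤
        2 / 15 * ((y - x) * y / (x ^ 2 + y ^ 2)) * 3.15 := by
      rw [← e2]
      have : 0 ≤ 1 + -x / y := by have := div_nonneg (neg_nonneg.mpr hx) hy.le; linarith
      have := Real.pi_lt_d2.le
      gcongr
    linarith
  rw [neg_div_next_eq hs hs1 hy, mul_div_assoc]
  have := mul_le_mul_of_nonneg_left key hs
  linarith

/-- Near the target the distance to it, in the norm `|x| + 8 |y|`, contracts. -/
lemma dist_next_le (hs : 0 ≤ s) (hs1 : s < 1) (hy : 0 < y) (hx : 1 / 4 ≤ x) :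
    |nextX s x y - 1| + 8 * nextY s x y ≤ (1 - s / 6) * (|x - 1| + 8 * y) := by
  have hpi := Real.pi_pos
  have hpi3 := Real.pi_gt_three
  have hx0 : 0 < x := by linarith
  set ρ := √(x ^ 2 + y ^ 2) with hρ
  have hρ2 : ρ ^ 2 = x ^ 2 + y ^ 2 := Real.sq_sqrt (by positivity)
  have hρ0 : 0 < ρ := Real.sqrt_pos.mpr (by positivity)
  have hθ : Real.arccos (x / ρ) ≤ 4 * y := by
    have h1 := Real.le_tan (Real.arccos_nonneg (x / ρ))
      (Real.arccos_lt_pi_div_two.mpr (by positivity))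
    have : 1 - (x / ρ) ^ 2 = (y / ρ) ^ 2 := by
      field_simp; linarith
    rw [Real.tan_arccos, this, Real.sqrt_sq (by positivity),
      div_div_div_cancel_right₀ hρ0.ne'] at h1
    refine h1.trans ?_
    rw [div_le_iff₀ hx0]
    nlinarith
  have hq0 : 0 ≤ y / (x ^ 2 + y ^ 2) := by positivity
  have hq2 : y / (x ^ 2 + y ^ 2) ≤ 2 := by
    rw [div_le_iff₀ (by positivity)]; nlinarith [sq_nonneg (x - y)]
  have hqx : y / (x ^ 2 + y ^ 2) * x ≤ 4 * y := by
    rw [div_mul_eq_mul_div, div_le_iff₀ (by positivity)]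
    have h1 : x ≤ 4 * (x ^ 2 + y ^ 2) := by nlinarith [sq_nonneg y]
    nlinarith
  have hsp : s / Real.pi ≤ s / 3 := by gcongr
  have hsp0 : 0 ≤ s / Real.pi := by positivity
  have hY : nextY s x y ≤ (1 - s / 3) * y := by
    unfold nextY growth
    have : s / Real.pi * (y / (x ^ 2 + y ^ 2)) ≤ s / 3 * 2 := by gcongr
    nlinarith
  have hX : |nextX s x y - 1| ≤ (1 - s) * |x - 1| + s * (4 / 3 * y) := by
    have e : nextX s x y - 1 = (1 - s) * (x - 1) +
        s / Real.pi * (y / (x ^ 2 + y ^ 2) * x - Real.arccos (x / ρ)) := by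
      unfold nextX growth
      rw [← hρ]
      field_simp
      ring
    rw [e]
    refine (abs_add_le _ _).trans ?_
    rw [abs_mul, abs_mul, abs_of_nonneg (show 0 ≤ 1 - s by linarith), abs_of_nonneg hsp0]
    have h1 : |y / (x ^ 2 + y ^ 2) * x - Real.arccos (x / ρ)| ≤ 4 * y := by
      rw [abs_le]
      have := Real.arccos_nonneg (x / ρ)
      have : 0 ≤ y / (x ^ 2 + y ^ 2) * x := by positivity
      constructor <;> linarith
    have h2 : s / Real.pi * |y / (x ^ 2 + y ^ 2) * x - Real.arccos (x / ρ)| ≤ s / 3 * (4 * y) := by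
      gcongr
    linarith
  have := mul_nonneg hs (abs_nonneg (x - 1))
  have := mul_nonneg hs hy.le
  linarith

end Step

section Trajectory

variable {s x y : ℕ → ℝ} {s₀ : ℝ}

/-- Global convergence of the planar dynamics. The four blocks of `N` steps make the tangent circle
bounded, the angle with the target acute, the coordinate along the target at least `1 / 4`, and the
distance to the target small. -/
lemma dist_le_of_planar_dynamics (hs₀ : 0 < s₀) (hs : ∀ t, s₀ ≤ s t) (hs1 : ∀ t, s t < 1)
    (hy : 0 < y 0) (hx' : ∀ t, x (t + 1) = nextX (s t) (x t) (y t))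
    (hy' : ∀ t, y (t + 1) = nextY (s t) (x t) (y t)) {N : ℕ} {D : ℝ}
    (hN : (1 - s₀ / 10) ^ N ≤ 1 / 2)
    (hNu : (1 - s₀ / 10) ^ N * ((x 0 ^ 2 + y 0 ^ 2) / y 0) ≤ 1)
    (hNp : (1 - s₀ / 10) ^ N * (1 + |x 0| / y 0) ≤ 1)
    (hND : (1 - s₀ / 10) ^ N * (|x 0| + 8 * y 0 + 6) ≤ D) {t : ℕ} (ht : 4 * N ≤ t) :
    |x t - 1| + 8 * y t ≤ D := by
  have hs0 : ∀ t, 0 ≤ s t := fun t => hs₀.le.trans (hs t)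
  set q := 1 - s₀ / 10 with hq
  have hs₀1 : s₀ < 1 := (hs 0).trans_lt (hs1 0)
  have hq0 : 0 < q := by rw [hq]; linarith
  have hq1 : q ≤ 1 := by rw [hq]; linarith
  have hpow : ∀ {m k : ℕ}, m ≤ k → q ^ k ≤ q ^ m := fun h => pow_le_pow_of_le_one hq0.le hq1 h
  have hypos : ∀ t, 0 < y t := by
    intro t
    induction t with
    | zero => exact hy
    | succ t ih => rw [hy']; exact mul_pos (growth_pos (hs0 t) (hs1 t) ih.le) ih
  have hstay : ∀ t, 0 ≤ x t → 0 ≤ x (t + 1) := by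
    intro t h
    rw [hx']
    have := le_nextX_of_nonneg (hs0 t) h (hypos t).le
    have := mul_nonneg (show 0 ≤ 1 - s t by linarith [hs1 t]) h
    linarith [hs0 t]
  have hstay' : ∀ t k, 0 ≤ x t → 0 ≤ x (t + k) := by
    intro t k h
    induction k with
    | zero => exact h
    | succ k ih => exact hstay _ ih
  -- the neuron leaves the half-plane opposite to the target within the first two blocks
  have hxN : 0 ≤ x (2 * N) := by
    by_contra hneg
    have hneg' : ∀ t, t ≤ 2 * N → x t < 0 := by
      intro t ht
      by_contra h
      have := hstay' t (2 * N - t) (not_lt.mp h)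
      rw [Nat.add_sub_cancel' ht] at this
      exact hneg this
    have hu : ∀ t, t ≤ 2 * N →
        (x t ^ 2 + y t ^ 2) / y t ≤ 1 / 3 + q ^ t * ((x 0 ^ 2 + y 0 ^ 2) / y 0) := by
      intro t
      induction t with
      | zero => intro _; simp
      | succ t ih =>
        intro ht
        have h1 := ih (by omega)
        have h2 := (hneg' (t + 1) ht).le
        rw [hx'] at h2
        have h3 := sq_div_next_le (hs0 t) (hs1 t) (hypos t) h2
        rw [← hx', ← hy'] at h3
        have h4 := mul_le_mul_of_nonneg_left h1 (show 0 ≤ 1 - s t by linarith [hs1 t])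
        have h5 : 0 ≤ q ^ t * ((x 0 ^ 2 + y 0 ^ 2) / y 0) := by positivity
        have h6 : (1 - s t) * (q ^ t * ((x 0 ^ 2 + y 0 ^ 2) / y 0)) ≤
            q * (q ^ t * ((x 0 ^ 2 + y 0 ^ 2) / y 0)) :=
          mul_le_mul_of_nonneg_right (by rw [hq]; linarith [hs t, hs0 t]) h5
        rw [pow_succ q t]
        linarith
    have hu' : ∀ t, N ≤ t → t ≤ 2 * N → (x t ^ 2 + y t ^ 2) / y t ≤ 4 / 3 := by
      intro t h1 h2
      have h3 := mul_le_mul_of_nonneg_right (hpow h1)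
        (show 0 ≤ (x 0 ^ 2 + y 0 ^ 2) / y 0 by positivity)
      linarith [hu t h2]
    have hp0 : ∀ t, -x t / y t ≤ -x 0 / y 0 := by
      intro t
      induction t with
      | zero => rfl
      | succ t ih =>
        rw [hx', hy']
        exact (neg_div_next_le (hs0 t) (hs1 t) (hypos t)).trans ih
    have hp : ∀ k, k ≤ N → 1 + -x (N + k) / y (N + k) ≤ q ^ k * (1 + -x 0 / y 0) := by
      intro k
      induction k with
      | zero => intro _; simpa using hp0 N
      | succ k ih =>
        intro hk
        have h1 := one_add_neg_div_next_le (hs0 (N + k)) (hs1 (N + k)) (hypos (N + k))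
          (hneg' _ (by omega)).le (hu' (N + k) (by omega) (by omega))
        rw [← hx', ← hy'] at h1
        have h2 : 0 ≤ 1 + -x (N + k) / y (N + k) := by
          have := div_nonneg (neg_nonneg.mpr (hneg' (N + k) (by omega)).le) (hypos (N + k)).le
          linarith
        have h3 : (1 - s (N + k) / 10) * (1 + -x (N + k) / y (N + k)) ≤
            q * (1 + -x (N + k) / y (N + k)) :=
          mul_le_mul_of_nonneg_right (by rw [hq]; linarith [hs (N + k)]) h2
        have h4 := mul_le_mul_of_nonneg_left (ih (by omega)) hq0.le
        rw [pow_succ, ← add_assoc]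
        linarith
    have h1 := hp N le_rfl
    rw [← two_mul] at h1
    have h2 : -x 0 / y 0 ≤ |x 0| / y 0 := by gcongr; exact neg_le_abs _
    have h3 := mul_le_mul_of_nonneg_left h2 (show 0 ≤ q ^ N by positivity)
    have h4 := div_pos (neg_pos.mpr (hneg' (2 * N) le_rfl)) (hypos (2 * N))
    linarith
  have hx2 : ∀ k, 1 / 2 * (1 - q ^ k) ≤ x (2 * N + k) := by
    intro k
    induction k with
    | zero => simpa using hxN
    | succ k ih =>
      have h1 := le_nextX_of_nonneg (hs0 (2 * N + k)) (hstay' _ k hxN) (hypos (2 * N + k)).le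
      rw [← hx'] at h1
      have h2 := mul_le_mul_of_nonneg_left ih
        (show 0 ≤ 1 - s (2 * N + k) by linarith [hs1 (2 * N + k)])
      have h3 : (1 - s (2 * N + k)) * q ^ k ≤ q * q ^ k :=
        mul_le_mul_of_nonneg_right (by rw [hq]; linarith [hs (2 * N + k), hs0 (2 * N + k)])
          (by positivity)
      rw [pow_succ, ← add_assoc]
      linarith
  have hx3 : ∀ t, 3 * N ≤ t → 1 / 4 ≤ x t := by
    intro t ht
    have h1 := hx2 (t - 2 * N)
    rw [Nat.add_sub_cancel' (show 2 * N ≤ t by omega)] at h1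
    have := hpow (show N ≤ t - 2 * N by omega)
    linarith
  have hV : ∀ t, |x t| + 8 * y t ≤ |x 0| + 8 * y 0 + 5 := by
    intro t
    induction t with
    | zero => linarith
    | succ t ih =>
      have h1 := abs_nextX_add_le (x := x t) (hs0 t) (hs1 t) (hypos t)
      rw [← hx', ← hy'] at h1
      have h2 := mul_le_mul_of_nonneg_left ih (show 0 ≤ 1 - s t by linarith [hs1 t])
      have h3 : 0 ≤ s t * (|x 0| + 8 * y 0) := by have := hs0 t; positivity
      linarith
  have hZ : ∀ k, |x (3 * N + k) - 1| + 8 * y (3 * N + k) ≤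
      q ^ k * (|x 0| + 8 * y 0 + 6) := by
    intro k
    induction k with
    | zero =>
      have h1 := hV (3 * N)
      have h2 := abs_sub (x (3 * N)) 1
      rw [abs_one] at h2
      simp only [add_zero, pow_zero, one_mul]
      linarith
    | succ k ih =>
      have h1 := dist_next_le (hs0 (3 * N + k)) (hs1 (3 * N + k)) (hypos (3 * N + k))
        (hx3 (3 * N + k) (by omega))
      rw [← hx', ← hy'] at h1
      have h2 : 0 ≤ |x (3 * N + k) - 1| + 8 * y (3 * N + k) := by
        have := hypos (3 * N + k); positivity
      have h3 : (1 - s (3 * N + k) / 6) * (|x (3 * N + k) - 1| + 8 * y (3 * N + k)) ≤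
          q * (|x (3 * N + k) - 1| + 8 * y (3 * N + k)) :=
        mul_le_mul_of_nonneg_right (by rw [hq]; linarith [hs (3 * N + k), hs0 (3 * N + k)]) h2
      have h4 := mul_le_mul_of_nonneg_left ih hq0.le
      rw [pow_succ, ← add_assoc]
      linarith
  have h1 := hZ (t - 3 * N)
  rw [Nat.add_sub_cancel' (show 3 * N ≤ t by omega)] at h1
  have h2 := mul_le_mul_of_nonneg_right (hpow (show N ≤ t - 3 * N by omega))
    (show 0 ≤ |x 0| + 8 * y 0 + 6 by positivity)
  linarith

end Trajectory

/-! ### From one neuron to planar coordinates -/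

section Neuron

variable {E : Type*} [NormedAddCommGroup E] [InnerProductSpace ℝ E] {v : E}

/-- Length of the component of `w` orthogonal to the unit vector `v`. -/
noncomputable def perpNorm (v w : E) : ℝ := ‖w - (inner ℝ w v : ℝ) • v‖

lemma norm_sq_eq_add_perpNorm_sq (hv : ‖v‖ = 1) (w : E) :
    ‖w‖ ^ 2 = inner ℝ w v ^ 2 + perpNorm v w ^ 2 := by
  rw [perpNorm, norm_sub_sq_real, inner_smul_right, norm_smul, hv]
  simp
  ring

lemma perpNorm_le_norm (hv : ‖v‖ = 1) (w : E) : perpNorm v w ≤ ‖w‖ := by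
  have := norm_sq_eq_add_perpNorm_sq hv w
  exact abs_le_of_sq_le_sq' (by nlinarith [sq_nonneg (inner ℝ w v)]) (norm_nonneg w) |>.2

lemma abs_inner_le_perpNorm {e : E} (hev : inner ℝ v e = 0) (he : ‖e‖ = 1) (w : E) :
    |inner ℝ w e| ≤ perpNorm v w := by
  have h := abs_real_inner_le_norm (w - (inner ℝ w v : ℝ) • v) e
  rw [inner_sub_left, inner_smul_left, hev, he] at h
  simpa [perpNorm] using h

lemma ne_zero_of_perpNorm_pos {w : E} (hw : 0 < perpNorm v w) : w ≠ 0 := by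
  rintro rfl
  simp [perpNorm] at hw

/-- One gradient step on a neuron, with effective step size `s`. -/
noncomputable def neuronStep (s : ℝ) (v w : E) : E := w - s • (w - pull v w)

lemma neuronStep_eq (hv : ‖v‖ = 1) {w : E} (hw : 0 < perpNorm v w) (s : ℝ) :
    neuronStep s v w = growth s (inner ℝ w v) (perpNorm v w) • w +
      (s * ((Real.pi - Real.arccos (inner ℝ w v / √(inner ℝ w v ^ 2 + perpNorm v w ^ 2))) /
        Real.pi)) • v := by
  have hn : ‖w‖ ^ 2 = inner ℝ w v ^ 2 + perpNorm v w ^ 2 := norm_sq_eq_add_perpNorm_sq hv w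
  have hw0 : 0 < ‖w‖ := norm_pos_iff.mpr (ne_zero_of_perpNorm_pos hw)
  have hsq : √(inner ℝ w v ^ 2 + perpNorm v w ^ 2) = ‖w‖ := by
    rw [← hn, Real.sqrt_sq hw0.le]
  have hsin : sinRatio v w = perpNorm v w / (inner ℝ w v ^ 2 + perpNorm v w ^ 2) := by
    have : 1 - (inner ℝ w v / ‖w‖) ^ 2 = (perpNorm v w / ‖w‖) ^ 2 := by
      field_simp; linarith
    rw [sinRatio, this, Real.sqrt_sq (by positivity), ← hn]
    field_simp
  rw [hsq, neuronStep, pull, hsin, growth]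
  module

lemma inner_neuronStep (hv : ‖v‖ = 1) {w : E} (hw : 0 < perpNorm v w) (s : ℝ) :
    inner ℝ (neuronStep s v w) v = nextX s (inner ℝ w v) (perpNorm v w) := by
  rw [neuronStep_eq hv hw, inner_add_left, inner_smul_left, inner_smul_left,
    real_inner_self_eq_norm_sq, hv, nextX]
  simp

lemma perpNorm_neuronStep (hv : ‖v‖ = 1) {w : E} (hw : 0 < perpNorm v w) {s : ℝ} (hs : 0 ≤ s)
    (hs1 : s < 1) :
    perpNorm v (neuronStep s v w) = nextY s (inner ℝ w v) (perpNorm v w) := by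
  have hg := growth_pos (x := inner ℝ w v) hs hs1 hw.le
  have key : neuronStep s v w - (inner ℝ (neuronStep s v w) v : ℝ) • v =
      growth s (inner ℝ w v) (perpNorm v w) • (w - (inner ℝ w v : ℝ) • v) := by
    rw [inner_neuronStep hv hw, neuronStep_eq hv hw, nextX]
    module
  calc perpNorm v (neuronStep s v w)
      = ‖growth s (inner ℝ w v) (perpNorm v w) • (w - (inner ℝ w v : ℝ) • v)‖ := by
        rw [perpNorm, key]
    _ = nextY s (inner ℝ w v) (perpNorm v w) := by
        rw [norm_smul, Real.norm_of_nonneg hg.le]; rfl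

/-- The loss of a neuron is at most its squared distance to the target. -/
lemma neuronLoss_le (hv : ‖v‖ = 1) (w : E) :
    neuronLoss v w ≤ (inner ℝ w v - 1) ^ 2 + perpNorm v w ^ 2 := by
  have hn := norm_sq_eq_add_perpNorm_sq hv w
  have hK : (inner ℝ w v : ℝ) ≤ ‖w‖ * reluKernel (inner ℝ w v / ‖w‖) := by
    rcases eq_or_ne w 0 with rfl | hw
    · simp
    · have hw0 : 0 < ‖w‖ := norm_pos_iff.mpr hw
      have h1 := abs_real_inner_div_norm_mul_norm_le_one w v
      rw [hv, mul_one, abs_le] at h1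
      have h2 := le_reluKernel h1.1 h1.2
      calc (inner ℝ w v : ℝ) = ‖w‖ * (inner ℝ w v / ‖w‖) := by field_simp
        _ ≤ _ := by gcongr
  rw [neuronLoss, hv]
  simp only [mul_one]
  nlinarith

lemma neuronLoss_le_of_neuronStep (hv : ‖v‖ = 1) {w : ℕ → E} {s : ℕ → ℝ} {s₀ : ℝ} (hs₀ : 0 < s₀)
    (hs : ∀ t, s₀ ≤ s t) (hs1 : ∀ t, s t < 1) (hw0 : 0 < perpNorm v (w 0))
    (hw : ∀ t, w (t + 1) = neuronStep (s t) v (w t)) {N : ℕ} {D : ℝ}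
    (hN : (1 - s₀ / 10) ^ N ≤ 1 / 2)
    (hNu : (1 - s₀ / 10) ^ N *
      ((inner ℝ (w 0) v ^ 2 + perpNorm v (w 0) ^ 2) / perpNorm v (w 0)) ≤ 1)
    (hNp : (1 - s₀ / 10) ^ N * (1 + |inner ℝ (w 0) v| / perpNorm v (w 0)) ≤ 1)
    (hND : (1 - s₀ / 10) ^ N * (|inner ℝ (w 0) v| + 8 * perpNorm v (w 0) + 6) ≤ D)
    {t : ℕ} (ht : 4 * N ≤ t) : neuronLoss v (w t) ≤ D ^ 2 := by
  have hpos : ∀ t, 0 < perpNorm v (w t) := by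
    intro t
    induction t with
    | zero => exact hw0
    | succ t ih =>
      rw [hw, perpNorm_neuronStep hv ih (hs₀.le.trans (hs t)) (hs1 t)]
      exact mul_pos (growth_pos (hs₀.le.trans (hs t)) (hs1 t) ih.le) ih
  have h := dist_le_of_planar_dynamics (s := s) (x := fun t => inner ℝ (w t) v)
    (y := fun t => perpNorm v (w t)) hs₀ hs hs1 hw0
    (fun t => by rw [hw, inner_neuronStep hv (hpos t)])
    (fun t => by rw [hw, perpNorm_neuronStep hv (hpos t) (hs₀.le.trans (hs t)) (hs1 t)])
    hN hNu hNp hND ht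
  refine (neuronLoss_le hv (w t)).trans ?_
  have h1 := hpos t
  rw [← sq_abs (inner ℝ (w t) v - 1)]
  have h2 := abs_nonneg (inner ℝ (w t) v - 1)
  nlinarith [mul_nonneg h2 h1.le]

end Neuron

/-! ### Row norms of the normalized adjacency matrix -/

section Adjacency

variable {n : ℕ} (G : SimpleGraph (Fin n)) [DecidableRel G.Adj] (train : Finset (Fin n))
  {dOut : Fin n → ℕ}

lemma adjMatrix_add_one_sq (i k : Fin n) :
    ((G.adjMatrix ℝ + 1) i k) ^ 2 = (G.adjMatrix ℝ + 1) i k := by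
  rw [Matrix.add_apply, SimpleGraph.adjMatrix_apply, Matrix.one_apply]
  rcases eq_or_ne i k with rfl | h
  · simp
  · by_cases ha : G.Adj i k <;> simp [h, ha]

lemma sum_adjMatrix_add_one (i : Fin n) :
    ∑ k, (G.adjMatrix ℝ + 1) i k = (G.degree i : ℝ) + 1 := by
  simp_rw [Matrix.add_apply, Finset.sum_add_distrib]
  congr 1
  · simp [SimpleGraph.adjMatrix_apply, ← SimpleGraph.card_neighborFinset_eq_degree,
      SimpleGraph.neighborFinset_eq_filter]
  · simp [Matrix.one_apply]

lemma normAdj_sq (i : train) (k : Fin n) :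
    normAdj G train dOut i k ^ 2 =
      ((G.degree (i : Fin n) : ℝ) + 1)⁻¹ * ((G.adjMatrix ℝ + 1) i k * ((dOut k : ℝ) + 1)⁻¹) := by
  rw [normAdj, Matrix.of_apply, mul_pow, mul_pow, adjMatrix_add_one_sq, inv_pow, inv_pow,
    Real.sq_sqrt (by positivity), Real.sq_sqrt (by positivity), mul_assoc]

lemma adjMatrix_add_one_nonneg (i k : Fin n) : 0 ≤ (G.adjMatrix ℝ + 1) i k := by
  rw [← adjMatrix_add_one_sq]; positivity

lemma meanRowSq_normAdj_le_one : meanRowSq (normAdj G train dOut) ≤ 1 := by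
  have h : ∀ i : train, ∑ k, normAdj G train dOut i k ^ 2 ≤ 1 := by
    intro i
    simp_rw [normAdj_sq, ← Finset.mul_sum]
    rw [inv_mul_le_iff₀ (by positivity), mul_one, ← sum_adjMatrix_add_one]
    refine Finset.sum_le_sum fun k _ => mul_le_of_le_one_right (adjMatrix_add_one_nonneg G _ _) ?_
    exact inv_le_one_of_one_le₀ (by linarith [(dOut k).cast_nonneg (α := ℝ)])
  unfold meanRowSq
  calc (train.card : ℝ)⁻¹ * ∑ i, ∑ k, normAdj G train dOut i k ^ 2
      ≤ (train.card : ℝ)⁻¹ * ∑ i : train, (1 : ℝ) := by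
        gcongr with i; exact h i
    _ = (train.card : ℝ)⁻¹ * train.card := by simp
    _ ≤ 1 := inv_mul_le_one

lemma le_meanRowSq_normAdj (hout : ∀ k, dOut k ≤ G.maxDegree) (htrain : train.Nonempty) :
    ((G.maxDegree : ℝ) + 1)⁻¹ ≤ meanRowSq (normAdj G train dOut) := by
  have h : ∀ i : train, ((G.maxDegree : ℝ) + 1)⁻¹ ≤ ∑ k, normAdj G train dOut i k ^ 2 := by
    intro i
    simp_rw [normAdj_sq, ← Finset.mul_sum]
    rw [le_inv_mul_iff₀ (by positivity), ← sum_adjMatrix_add_one, Finset.sum_mul]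
    refine Finset.sum_le_sum fun k _ => mul_le_mul_of_nonneg_left ?_
      (adjMatrix_add_one_nonneg G _ _)
    gcongr
    exact hout k
  have hc : (0 : ℝ) < train.card := by exact_mod_cast htrain.card_pos
  unfold meanRowSq
  calc ((G.maxDegree : ℝ) + 1)⁻¹ = (train.card : ℝ)⁻¹ *
        ∑ i : train, ((G.maxDegree : ℝ) + 1)⁻¹ := by simp; field_simp
    _ ≤ _ := by gcongr with i; exact h i

lemma trainOutDegree_le (k : Fin n) : trainOutDegree G train k ≤ G.maxDegree := by
  refine le_trans ?_ (G.degree_le_maxDegree k)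
  rw [trainOutDegree, ← SimpleGraph.card_neighborFinset_eq_degree]
  refine Finset.card_le_card fun i hi => ?_
  simpa [G.adj_comm] using (Finset.mem_filter.mp hi).2

end Adjacency

/-! ### Gradient descent acts neuron by neuron -/

lemma rowL_gradDescent {n r h : ℕ} {train : Finset (Fin n)} (A : Matrix train (Fin n) ℝ)
    {Wstar : Matrix (Fin h) (Fin r) ℝ}
    (hstar : ∀ j, ‖(WithLp.toLp 2 (Wstar j) : EuclideanSpace ℝ (Fin r))‖ = 1)
    (η : ℕ → ℝ) (W₀ : Params h r) (t : ℕ)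
    (hW : ∀ j, rowL h r j (gradDescent (trainRisk A Wstar) η W₀ t) ≠ 0) (j : Fin h) :
    rowL h r j (gradDescent (trainRisk A Wstar) η W₀ (t + 1)) =
      neuronStep (η t * meanRowSq A) (WithLp.toLp 2 (Wstar j))
        (rowL h r j (gradDescent (trainRisk A Wstar) η W₀ t)) := by
  rw [gradDescent, map_sub, map_smul, rowL_gradient_trainRisk A hstar hW, neuronStep, smul_smul]

/-- Gradient descent from an initialization none of whose rows is parallel to its target row: no row
of an iterate vanishes, so the risk is differentiable there, and the risk becomes small. The bounds
`P` and `Q` on the initial slopes and sizes enter only through the number `N`. -/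
lemma trainRisk_gradDescent_le {n r h : ℕ} {train : Finset (Fin n)} (A : Matrix train (Fin n) ℝ)
    (hA : meanRowSq A ≤ 1) {Wstar : Matrix (Fin h) (Fin r) ℝ}
    (hstar : ∀ j, ‖(WithLp.toLp 2 (Wstar j) : EuclideanSpace ℝ (Fin r))‖ = 1)
    {η : ℕ → ℝ} {s₀ : ℝ} (hs₀ : 0 < s₀) (hs : ∀ t, s₀ ≤ η t * meanRowSq A)
    (hs1 : ∀ t, η t * meanRowSq A < 1) {W₀ : Params h r} {N : ℕ} {P Q D : ℝ}
    (hP : 1 ≤ P) (hQ : 0 ≤ Q)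
    (hpos : ∀ j, 0 < perpNorm (WithLp.toLp 2 (Wstar j)) (rowL h r j W₀))
    (hslope : ∀ j, |inner ℝ (rowL h r j W₀) (WithLp.toLp 2 (Wstar j))| ≤
      P * perpNorm (WithLp.toLp 2 (Wstar j)) (rowL h r j W₀))
    (hinner : ∀ j, |inner ℝ (rowL h r j W₀) (WithLp.toLp 2 (Wstar j))| ≤ Q)
    (hperp : ∀ j, perpNorm (WithLp.toLp 2 (Wstar j)) (rowL h r j W₀) ≤ Q)
    (hNu : (1 - s₀ / 10) ^ N * (2 * P * (Q + 1)) ≤ 1)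
    (hND : (1 - s₀ / 10) ^ N * (9 * Q + 6) ≤ D) :
    (∀ t, DifferentiableAt ℝ (trainRisk A Wstar) (gradDescent (trainRisk A Wstar) η W₀ t)) ∧
      ∀ t, 4 * N ≤ t → trainRisk A Wstar (gradDescent (trainRisk A Wstar) η W₀ t) ≤
        h * D ^ 2 / 2 := by
  set W := gradDescent (trainRisk A Wstar) η W₀ with hW
  let v : Fin h → EuclideanSpace ℝ (Fin r) := fun j => WithLp.toLp 2 (Wstar j)
  have hs₀1 : s₀ < 1 := (hs 0).trans_lt (hs1 0)
  have hall : ∀ t j, 0 < perpNorm (v j) (rowL h r j (W t)) := by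
    intro t
    induction t with
    | zero => exact hpos
    | succ t ih =>
      intro j
      have h1 : ∀ j, rowL h r j (W t) ≠ 0 := fun j => ne_zero_of_perpNorm_pos (ih j)
      rw [hW, rowL_gradDescent A hstar η W₀ t h1 j,
        perpNorm_neuronStep (hstar j) (ih j) (hs₀.le.trans (hs t)) (hs1 t)]
      exact mul_pos (growth_pos (hs₀.le.trans (hs t)) (hs1 t) (ih j).le) (ih j)
  have hne : ∀ t j, rowL h r j (W t) ≠ 0 := fun t j => ne_zero_of_perpNorm_pos (hall t j)
  refine ⟨fun t => (hasGradientAt_trainRisk A hstar (hne t)).differentiableAt, fun t ht => ?_⟩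
  have hq0 : 0 ≤ (1 - s₀ / 10) ^ N := pow_nonneg (by linarith) N
  have hPQ : P + Q ≤ P * (Q + 1) := by nlinarith
  have hloss : ∀ j, neuronLoss (v j) (rowL h r j (W t)) ≤ D ^ 2 := by
    intro j
    have hy := hpos j
    have hx := hslope j
    have hxQ := hinner j
    have hyQ := hperp j
    refine neuronLoss_le_of_neuronStep (hstar j) (w := fun t => rowL h r j (W t)) hs₀ hs hs1 hy
      (fun t => rowL_gradDescent A hstar η W₀ t (hne t) j) ?_ ?_ ?_ ?_ ht
    · have := mul_le_mul_of_nonneg_left (show 2 ≤ 2 * P * (Q + 1) by linarith) hq0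
      linarith
    · refine le_trans (mul_le_mul_of_nonneg_left ?_ hq0) hNu
      change (inner ℝ (rowL h r j W₀) (WithLp.toLp 2 (Wstar j)) ^ 2 +
        perpNorm (WithLp.toLp 2 (Wstar j)) (rowL h r j W₀) ^ 2) /
        perpNorm (WithLp.toLp 2 (Wstar j)) (rowL h r j W₀) ≤ _
      rw [div_le_iff₀ hy, ← sq_abs (inner ℝ (rowL h r j W₀) (WithLp.toLp 2 (Wstar j)))]
      have h1 := mul_le_mul hx hxQ (abs_nonneg _) (by positivity)
      have h2 := mul_le_mul_of_nonneg_right (hyQ.trans (show Q ≤ P * (Q + 1) by linarith)) hy.le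
      have h3 := mul_nonneg (show 0 ≤ P by linarith) hy.le
      linarith
    · refine le_trans (mul_le_mul_of_nonneg_left ?_ hq0) hNu
      have h1 : |inner ℝ (rowL h r j W₀) (WithLp.toLp 2 (Wstar j))| /
        perpNorm (WithLp.toLp 2 (Wstar j)) (rowL h r j W₀) ≤ P := by
        rw [div_le_iff₀ hy]; exact hx
      have h2 : 1 + P ≤ 2 * P * (Q + 1) := by linarith
      exact (add_le_add le_rfl h1).trans h2
    · refine le_trans (mul_le_mul_of_nonneg_left ?_ hq0) hND
      change |inner ℝ (rowL h r j W₀) (WithLp.toLp 2 (Wstar j))| + 8 *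
        perpNorm (WithLp.toLp 2 (Wstar j)) (rowL h r j W₀) + 6 ≤ _
      linarith
  have hA0 : 0 ≤ meanRowSq A := by unfold meanRowSq; positivity
  rw [trainRisk_eq]
  calc meanRowSq A / 2 * ∑ j, neuronLoss (v j) (rowL h r j (W t))
      ≤ meanRowSq A / 2 * ∑ _j : Fin h, D ^ 2 := by gcongr with j; exact hloss j
    _ = meanRowSq A * (h * D ^ 2 / 2) := by simp; ring
    _ ≤ 1 * (h * D ^ 2 / 2) := by gcongr
    _ = _ := one_mul _

/-! ### Gaussian initialization -/

lemma initLaw_eq (h r : ℕ) (κ : ℝ) :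
    initLaw h r κ = (stdGaussian (Params h r)).map (fun W => κ • W) := by
  have hm : Measurable fun W : Params h r => κ • W := by fun_prop
  obtain ⟨σ2, hσ, hinit⟩ : ∃ σ2 : ℝ≥0, (σ2 : ℝ) = κ ^ 2 ∧ initLaw h r κ =
      (Measure.pi fun _ : Fin h × Fin r => gaussianReal 0 σ2).map (WithLp.toLp 2) :=
    ⟨⟨κ ^ 2, sq_nonneg κ⟩, rfl, rfl⟩
  rw [hinit]
  have h1 : IsProbabilityMeasure
      ((Measure.pi fun _ : Fin h × Fin r => gaussianReal 0 σ2).map (WithLp.toLp 2)) :=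
    Measure.isProbabilityMeasure_map (by fun_prop)
  have h2 := Measure.isProbabilityMeasure_map (μ := stdGaussian (Params h r)) hm.aemeasurable
  apply Measure.ext_of_charFun
  ext t
  rw [charFun_map_smul, charFun_stdGaussian, charFun_pi]
  simp_rw [charFun_gaussianReal, ← Complex.exp_sum]
  congr 1
  rw [← Complex.ofReal_pow, norm_smul, mul_pow, EuclideanSpace.norm_sq_eq]
  push_cast
  simp [Finset.sum_div, neg_div, ← Complex.ofReal_pow, Finset.mul_sum, hσ]

/-- A linear form of unit norm in a standard Gaussian vector is a standard Gaussian variable. -/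
lemma map_inner_stdGaussian {E : Type*} [NormedAddCommGroup E] [InnerProductSpace ℝ E]
    [FiniteDimensional ℝ E] [MeasurableSpace E] [BorelSpace E] {p : E} (hp : ‖p‖ = 1) :
    (stdGaussian E).map (fun x => inner ℝ p x) = gaussianReal 0 1 := by
  have := IsGaussian.map_eq_gaussianReal (μ := stdGaussian E) (innerSL ℝ p)
  rw [integral_strongDual_stdGaussian, variance_dual_stdGaussian, innerSL_apply_norm, hp] at this
  simpa using this

/-- The density of a standard Gaussian variable is at most `1 / 2`. -/
lemma gaussianReal_Ioo_le (δ : ℝ) :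
    gaussianReal 0 1 (Set.Ioo (-δ) δ) ≤ ENNReal.ofReal δ := by
  rw [gaussianReal_apply 0 one_ne_zero]
  calc ∫⁻ x in Set.Ioo (-δ) δ, gaussianPDF 0 1 x
      ≤ ∫⁻ _x in Set.Ioo (-δ) δ, ENNReal.ofReal (1 / 2) := by
        refine lintegral_mono fun x => ENNReal.ofReal_le_ofReal ?_
        rw [gaussianPDFReal]
        have h1 : Real.exp (-(x - 0) ^ 2 / (2 * ((1 : ℝ≥0) : ℝ))) ≤ 1 :=
          Real.exp_le_one_iff.mpr (by
            have := sq_nonneg (x - 0)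
            simp only [NNReal.coe_one, mul_one]
            linarith)
        have h2 : (√(2 * Real.pi * ((1 : ℝ≥0) : ℝ)))⁻¹ ≤ 1 / 2 := by
          rw [one_div]
          refine inv_anti₀ (by norm_num) (Real.le_sqrt_of_sq_le ?_)
          have := Real.pi_gt_three
          simp only [NNReal.coe_one, mul_one]
          linarith
        calc _ ≤ 1 / 2 * (1 : ℝ) := mul_le_mul h2 h1 (Real.exp_pos _).le (by norm_num)
          _ = 1 / 2 := by norm_num
    _ = ENNReal.ofReal δ := by
        rw [setLIntegral_const, Real.volume_Ioo, ← ENNReal.ofReal_mul (by norm_num)]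
        congr 1
        ring

/-- Chebyshev's inequality for a standard Gaussian variable. -/
lemma gaussianReal_le_abs_le {B : ℝ} (hB : 0 < B) :
    gaussianReal 0 1 {x | B ≤ |x|} ≤ ENNReal.ofReal (1 / B ^ 2) := by
  have h := meas_ge_le_variance_div_sq (μ := gaussianReal 0 1) (X := id)
    (memLp_id_gaussianReal 2) hB
  simpa [variance_id_gaussianReal] using h

/-- Embedding of a row vector as the `j`-th row of a parameter vector. -/
noncomputable def rowEmb {h r : ℕ} (j : Fin h) (u : EuclideanSpace ℝ (Fin r)) : Params h r :=
  WithLp.toLp 2 fun jl => if jl.1 = j then u jl.2 else 0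

lemma inner_rowEmb {h r : ℕ} (j : Fin h) (u : EuclideanSpace ℝ (Fin r)) (W : Params h r) :
    inner ℝ (rowEmb j u) W = inner ℝ (rowL h r j W) u := by
  simp [rowEmb, PiLp.inner_apply, Fintype.sum_prod_type, mul_comm]

lemma norm_rowEmb {h r : ℕ} (j : Fin h) (u : EuclideanSpace ℝ (Fin r)) :
    ‖(rowEmb j u : Params h r)‖ = ‖u‖ := by
  have : rowL h r j (rowEmb j u) = u := by ext l; simp [rowEmb]
  rw [@norm_eq_sqrt_real_inner (Params h r), inner_rowEmb, this, ← norm_eq_sqrt_real_inner]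

lemma map_inner_rowL_stdGaussian {h r : ℕ} (j : Fin h) {u : EuclideanSpace ℝ (Fin r)}
    (hu : ‖u‖ = 1) :
    (stdGaussian (Params h r)).map (fun W => inner ℝ (rowL h r j W) u) = gaussianReal 0 1 := by
  have := map_inner_stdGaussian (p := (rowEmb j u : Params h r)) (by rw [norm_rowEmb, hu])
  simpa [inner_rowEmb] using this

lemma integral_norm_rowL_sq {h r : ℕ} (j : Fin h) :
    Integrable (fun W => ‖rowL h r j W‖ ^ 2) (stdGaussian (Params h r)) ∧
    ∫ W, ‖rowL h r j W‖ ^ 2 ∂(stdGaussian (Params h r)) = r := by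
  have hsq : ∀ l, Integrable (fun W : Params h r => (W (j, l)) ^ 2) (stdGaussian (Params h r)) ∧
      ∫ W, (W (j, l)) ^ 2 ∂(stdGaussian (Params h r)) = 1 := by
    intro l
    have hmap := map_inner_rowL_stdGaussian (h := h) j
      (u := (EuclideanSpace.single l (1 : ℝ) : EuclideanSpace ℝ (Fin r))) (by simp)
    have hval : ∀ W : Params h r,
        inner ℝ (rowL h r j W) (EuclideanSpace.single l (1 : ℝ)) = W (j, l) := by
      intro W; simp [EuclideanSpace.inner_single_right]
    simp_rw [hval] at hmap
    have hm : Measurable fun W : Params h r => W (j, l) := by fun_prop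
    have hmem : MemLp (fun x : ℝ => x) 2 (gaussianReal 0 1) := memLp_id_gaussianReal 2
    constructor
    · have := hmem.integrable_sq
      rw [← hmap] at this
      exact (integrable_map_measure this.aestronglyMeasurable hm.aemeasurable).mp this
    · have h1 := variance_id_gaussianReal (μ := 0) (v := 1)
      rw [variance_of_integral_eq_zero aemeasurable_id (by simp)] at h1
      rw [← hmap, integral_map hm.aemeasurable (by
        apply Continuous.aestronglyMeasurable; fun_prop)] at h1
      simpa using h1
  have hn : ∀ W : Params h r, ‖rowL h r j W‖ ^ 2 = ∑ l, W (j, l) ^ 2 := by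
    intro W; simp [EuclideanSpace.norm_sq_eq]
  simp_rw [hn]
  exact ⟨integrable_finsetSum _ fun l _ => (hsq l).1, by
    rw [integral_finsetSum _ fun l _ => (hsq l).1]; simp [(hsq _).2]⟩

lemma stdGaussian_norm_rowL_ge_le {h r : ℕ} (j : Fin h) {κ M B : ℝ} (hκ : 0 < κ)
    (hM : 0 < M) (hB : 0 < B) (hκM : κ * √(r : ℝ) ≤ M) :
    stdGaussian (Params h r) {W | M * B ≤ κ * ‖rowL h r j W‖} ≤ ENNReal.ofReal (1 / B ^ 2) := by
  obtain ⟨hint, hval⟩ := integral_norm_rowL_sq (h := h) (r := r) j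
  have hmk := mul_meas_ge_le_integral_of_nonneg (μ := stdGaussian (Params h r))
    (Filter.Eventually.of_forall fun W => sq_nonneg ‖rowL h r j W‖) hint ((M * B / κ) ^ 2)
  rw [hval] at hmk
  have hset : {W : Params h r | M * B ≤ κ * ‖rowL h r j W‖} ⊆
      {W | (M * B / κ) ^ 2 ≤ ‖rowL h r j W‖ ^ 2} := by
    intro W hW
    have hW : M * B ≤ κ * ‖rowL h r j W‖ := hW
    have : M * B / κ ≤ ‖rowL h r j W‖ := by rw [div_le_iff₀ hκ]; linarith
    exact pow_le_pow_left₀ (by positivity) this 2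
  refine (measure_mono hset).trans ?_
  rw [← ofReal_measureReal]
  refine ENNReal.ofReal_le_ofReal ?_
  have hr : κ ^ 2 * r ≤ M ^ 2 := by
    have := pow_le_pow_left₀ (by positivity) hκM 2
    rwa [mul_pow, Real.sq_sqrt (by positivity)] at this
  rw [le_div_iff₀ (by positivity)]
  have h3 : M ^ 2 * (B ^ 2 * (stdGaussian (Params h r)).real
      {W | (M * B / κ) ^ 2 ≤ ‖rowL h r j W‖ ^ 2}) ≤ M ^ 2 := by
    refine le_trans ?_ hr
    calc _ = κ ^ 2 * ((M * B / κ) ^ 2 * (stdGaussian (Params h r)).real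
          {W | (M * B / κ) ^ 2 ≤ ‖rowL h r j W‖ ^ 2}) := by field_simp
      _ ≤ _ := by gcongr
  have h4 : 0 < M ^ 2 := by positivity
  have := le_of_mul_le_mul_left (h3.trans_eq (mul_one _).symm) h4
  linarith

lemma exists_unit_orthogonal {r : ℕ} (hr : 2 ≤ r) (v : EuclideanSpace ℝ (Fin r)) :
    ∃ e : EuclideanSpace ℝ (Fin r), ‖e‖ = 1 ∧ inner ℝ v e = 0 := by
  have hlt : Module.finrank ℝ (ℝ ∙ v) < Module.finrank ℝ (EuclideanSpace ℝ (Fin r)) := by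
    have := finrank_span_le_card (R := ℝ) ({v} : Set (EuclideanSpace ℝ (Fin r)))
    simp at this ⊢
    omega
  have hne : (ℝ ∙ v)ᗮ ≠ ⊥ := by
    intro h
    rw [Submodule.orthogonal_eq_bot_iff] at h
    rw [h, finrank_top] at hlt
    exact hlt.false
  obtain ⟨x, hx, hx0⟩ := Submodule.exists_mem_ne_zero_of_ne_bot hne
  refine ⟨‖x‖⁻¹ • x, by simp [norm_smul, hx0], ?_⟩
  rw [inner_smul_right, Submodule.mem_orthogonal_singleton_iff_inner_right.mp hx, mul_zero]

/-- With high probability no row of the initialization is large, long in the direction of its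
target, or nearly parallel to its target. -/
lemma initLaw_bad_le {h r : ℕ} (hr : 2 ≤ r) {κ M B : ℝ} (hκ : 0 < κ) (hM : 0 < M) (hB : 1 ≤ B)
    (hκM : κ * √(r : ℝ) ≤ M) {v : Fin h → EuclideanSpace ℝ (Fin r)} (hv : ∀ j, ‖v j‖ = 1) :
    initLaw h r κ {W | ¬ ∀ j, κ / B ≤ perpNorm (v j) (rowL h r j W) ∧
      |inner ℝ (rowL h r j W) (v j)| ≤ κ * B ∧ ‖rowL h r j W‖ ≤ M * B} ≤
      ENNReal.ofReal (h * (3 / B)) := by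
  have hB0 : 0 < B := by linarith
  choose e he hev using fun j => exists_unit_orthogonal hr (v j)
  let S : Fin h → Set (Params h r) := fun j =>
    {W | |inner ℝ (rowL h r j W) (e j)| < 1 / B} ∪ {W | B ≤ |inner ℝ (rowL h r j W) (v j)|} ∪
      {W | M * B ≤ κ * ‖rowL h r j W‖}
  have hm : Measurable fun W : Params h r => κ • W := by fun_prop
  have hmu : ∀ j (u : EuclideanSpace ℝ (Fin r)),
      Measurable fun W : Params h r => inner ℝ (rowL h r j W) u := by
    intro j u; apply Continuous.measurable; fun_prop
  have hS : ∀ j, stdGaussian (Params h r) (S j) ≤ ENNReal.ofReal (3 / B) := by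
    intro j
    have h1 : stdGaussian (Params h r) {W | |inner ℝ (rowL h r j W) (e j)| < 1 / B} ≤
        ENNReal.ofReal (1 / B) := by
      have := gaussianReal_Ioo_le (1 / B)
      rw [← map_inner_rowL_stdGaussian j (he j), Measure.map_apply (hmu j _)
        measurableSet_Ioo] at this
      refine le_trans (measure_mono fun W hW => ?_) this
      exact abs_lt.mp hW
    have h2 : stdGaussian (Params h r) {W | B ≤ |inner ℝ (rowL h r j W) (v j)|} ≤
        ENNReal.ofReal (1 / B ^ 2) := by
      have := gaussianReal_le_abs_le hB0
      rwa [← map_inner_rowL_stdGaussian j (hv j), Measure.map_apply (hmu j _)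
        (measurableSet_le measurable_const (by fun_prop))] at this
    have h3 := stdGaussian_norm_rowL_ge_le j hκ hM hB0 hκM
    have h4 : 1 / B ^ 2 ≤ 1 / B := by
      gcongr; nlinarith
    calc stdGaussian (Params h r) (S j)
        ≤ ENNReal.ofReal (1 / B) + ENNReal.ofReal (1 / B ^ 2) + ENNReal.ofReal (1 / B ^ 2) :=
          (measure_union_le _ _).trans
            (add_le_add ((measure_union_le _ _).trans (add_le_add h1 h2)) h3)
      _ ≤ ENNReal.ofReal (1 / B) + ENNReal.ofReal (1 / B) + ENNReal.ofReal (1 / B) := by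
          gcongr
      _ = ENNReal.ofReal (3 / B) := by
          rw [← ENNReal.ofReal_add (by positivity) (by positivity),
            ← ENNReal.ofReal_add (by positivity) (by positivity)]
          congr 1; ring
  rw [initLaw_eq]
  have hbad : MeasurableSet {W : Params h r | ¬ ∀ j, κ / B ≤ perpNorm (v j) (rowL h r j W) ∧
      |inner ℝ (rowL h r j W) (v j)| ≤ κ * B ∧ ‖rowL h r j W‖ ≤ M * B} := by
    have hset : {W : Params h r | ¬ ∀ j, κ / B ≤ perpNorm (v j) (rowL h r j W) ∧
        |inner ℝ (rowL h r j W) (v j)| ≤ κ * B ∧ ‖rowL h r j W‖ ≤ M * B} =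
        (⋂ j, {W | κ / B ≤ perpNorm (v j) (rowL h r j W)} ∩
          ({W | |inner ℝ (rowL h r j W) (v j)| ≤ κ * B} ∩ {W | ‖rowL h r j W‖ ≤ M * B}))ᶜ := by
      ext W
      simp
    have hp : ∀ j, Measurable fun W : Params h r => perpNorm (v j) (rowL h r j W) := by
      intro j; unfold perpNorm; apply Continuous.measurable; fun_prop
    rw [hset]
    exact (MeasurableSet.iInter fun j => (measurableSet_le measurable_const (hp j)).inter
      ((measurableSet_le (hmu j (v j)).abs measurable_const).inter
        (measurableSet_le (by fun_prop) measurable_const))).compl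
  rw [Measure.map_apply hm hbad]
  calc _ ≤ stdGaussian (Params h r) (⋃ j, S j) := by
        refine measure_mono fun W hW => ?_
        by_contra hcon
        simp only [S, Set.mem_iUnion, Set.mem_union, Set.mem_ofPred_eq, not_exists, not_or,
          not_lt, not_le] at hcon
        refine hW fun j => ?_
        obtain ⟨⟨h1, h2⟩, h3⟩ := hcon j
        have hE := abs_inner_le_perpNorm (hev j) (he j) (rowL h r j (κ • W))
        rw [map_smul, inner_smul_left, abs_mul] at hE
        rw [map_smul, inner_smul_left, abs_mul, norm_smul]
        simp only [conj_trivial, abs_of_pos hκ, Real.norm_eq_abs] at hE ⊢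
        refine ⟨?_, by gcongr, h3.le⟩
        refine le_trans ?_ hE
        rw [div_eq_mul_one_div]
        gcongr
    _ ≤ ∑ j, stdGaussian (Params h r) (S j) := measure_iUnion_fintype_le _ _
    _ ≤ ∑ _j : Fin h, ENNReal.ofReal (3 / B) := Finset.sum_le_sum fun j _ => hS j
    _ = ENNReal.ofReal (h * (3 / B)) := by
        rw [ENNReal.ofReal_mul (by positivity)]; simp

/-! ### Counting steps -/

/-- The logarithm of the required contraction factor is dominated by `√m h² ε⁻¹ log (h² / ε)`. -/
lemma log_target_le {M a m h ε : ℝ} (hM : 0 < M) (ha : 0 < a) (hm : 1 ≤ m) (hh : 2 ≤ h)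
    (hε : 0 < ε) (hε1 : ε < 1) :
    Real.log (9 * (M + 1) * (3 * (m * h) ^ (a + 1)) ^ 3 * (h / ε)) ≤
      (Real.log (9 * (M + 1)) + 3 * Real.log 3 + 9 * (a + 1) + 1) *
        (m ^ (1 / 2 : ℝ) * h ^ 2 * ε⁻¹ * Real.log (h ^ 2 / ε)) := by
  have hm0 : 0 < m := by linarith
  have hh0 : 0 < h := by linarith
  set ℓ := Real.log (h ^ 2 / ε) with hℓ
  have hle : h / ε ≤ h ^ 2 / ε := by gcongr; nlinarith
  have h4 : 4 ≤ h ^ 2 / ε := by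
    rw [le_div_iff₀ hε]; nlinarith
  have hℓ1 : 1 ≤ ℓ := by
    rw [hℓ, Real.le_log_iff_exp_le (by linarith)]
    linarith [Real.exp_one_lt_d9]
  have hsm : 1 ≤ m ^ (1 / 2 : ℝ) := Real.one_le_rpow hm (by norm_num)
  have hcoef : 1 ≤ h ^ 2 * ε⁻¹ := by
    rw [← div_eq_mul_inv]; linarith
  set X := m ^ (1 / 2 : ℝ) * h ^ 2 * ε⁻¹ * ℓ with hX
  have hX' : X = m ^ (1 / 2 : ℝ) * ((h ^ 2 * ε⁻¹) * ℓ) := by rw [hX]; ring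
  have hone : 1 ≤ (h ^ 2 * ε⁻¹) * ℓ := one_le_mul_of_one_le_of_one_le hcoef hℓ1
  have hℓX : ℓ ≤ X := by
    have : ℓ ≤ (h ^ 2 * ε⁻¹) * ℓ := le_mul_of_one_le_left (by linarith) hcoef
    rw [hX']
    exact this.trans (le_mul_of_one_le_left (by linarith) hsm)
  have hmX : m ^ (1 / 2 : ℝ) ≤ X := by
    rw [hX']; exact le_mul_of_one_le_right (by linarith) hone
  have hX1 : 1 ≤ X := hℓ1.trans hℓX
  have l1 : Real.log (h / ε) ≤ X :=
    (Real.log_le_log (by positivity) hle).trans hℓX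
  have l2 : Real.log h ≤ X := by
    refine le_trans (Real.log_le_log hh0 ?_) l1
    rw [le_div_iff₀ hε]; nlinarith
  have l3 : Real.log m ≤ 2 * X := by
    have := Real.log_le_rpow_div hm0.le (show (0 : ℝ) < 1 / 2 by norm_num)
    linarith
  have l4 : Real.log (9 * (M + 1)) ≤ Real.log (9 * (M + 1)) * X :=
    le_mul_of_one_le_right (Real.log_nonneg (by linarith)) hX1
  have l5 : Real.log 3 ≤ Real.log 3 * X :=
    le_mul_of_one_le_right (Real.log_nonneg (by norm_num)) hX1
  have l6 := mul_le_mul_of_nonneg_left (add_le_add l3 l2) (show 0 ≤ 3 * (a + 1) by linarith)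
  rw [Real.log_mul (x := 9 * (M + 1) * (3 * (m * h) ^ (a + 1)) ^ 3) (by positivity) (by positivity),
    Real.log_mul (x := 9 * (M + 1)) (by positivity) (by positivity), Real.log_pow,
    Real.log_mul (x := 3) (by norm_num) (by positivity), Real.log_rpow (by positivity),
    Real.log_mul hm0.ne' hh0.ne']
  push_cast
  linarith

lemma one_sub_pow_le_inv {q Λ : ℝ} {N : ℕ} (hq : q ≤ 1) (hΛ : 0 < Λ) (hN : Real.log Λ ≤ q * N) :
    (1 - q) ^ N ≤ Λ⁻¹ := by
  calc (1 - q) ^ N ≤ Real.exp (-q) ^ N :=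
        pow_le_pow_left₀ (by linarith) (Real.one_sub_le_exp_neg q) N
    _ = Real.exp (-(q * N)) := by rw [← Real.exp_nat_mul]; congr 1; ring
    _ ≤ Real.exp (-Real.log Λ) := Real.exp_le_exp.mpr (by linarith)
    _ = Λ⁻¹ := by rw [Real.exp_neg, Real.exp_log hΛ]

/-- Four blocks of steps, each contracting by `Λ`, fit into the step budget. The term under the
fraction bar is the smallest effective step size, of order `d² / m³`; only `d^(-1/2)` of the
available `d^(-2)` is used. -/
lemma four_mul_ceil_le {c d m Λ K X : ℝ} (hc : 0 < c) (hc1 : c ≤ 1) (hd : 1 ≤ d) (hm : 1 ≤ m)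
    (hdm : d ≤ m) (hΛ : 1 ≤ Real.log Λ) (hX : Real.log Λ ≤ K * (m ^ (1 / 2 : ℝ) * X)) :
    ((4 * ⌈10 * Real.log Λ / (c * d ^ 3 / (Real.pi * m ^ 3) * (d + 1)⁻¹)⌉₊ : ℕ) : ℝ) ≤
      88 * Real.pi * K / c * (m ^ (7 / 2 : ℝ) * d ^ (-(1 / 2) : ℝ) * X) := by
  have hpi := Real.pi_pos
  have hm0 : 0 < m := by linarith
  have hd0 : 0 < d := by linarith
  set s₀ := c * d ^ 3 / (Real.pi * m ^ 3) * (d + 1)⁻¹ with hs₀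
  have hs0 : 0 < s₀ := by positivity
  have hs1 : s₀ ≤ 1 := by
    have h1 : c * d ^ 3 / (Real.pi * m ^ 3) ≤ 1 := by
      rw [div_le_one (by positivity)]
      have : d ^ 3 ≤ m ^ 3 := by gcongr
      have h3 := Real.pi_gt_three
      exact mul_le_mul (by linarith) this (by positivity) hpi.le
    exact mul_le_one₀ h1 (by positivity) (inv_le_one_of_one_le₀ (by linarith))
  have hL0 : 0 ≤ Real.log Λ := by linarith
  have h1 : (1 : ℝ) ≤ Real.log Λ / s₀ := by
    rw [le_div_iff₀ hs0]; linarith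
  have h2 := (Nat.ceil_lt_add_one (show 0 ≤ 10 * Real.log Λ / s₀ by positivity)).le
  rw [mul_div_assoc] at h2 ⊢
  have h3 : 1 / s₀ ≤ 2 * Real.pi / c * (m ^ 3 * d ^ (-(1 / 2) : ℝ)) := by
    have e1 : 1 / s₀ = Real.pi / c * m ^ 3 * ((d + 1) / d ^ 3) := by
      rw [hs₀]; field_simp
    have e2 : (d + 1) / d ^ 3 ≤ 2 * d ^ (-(2 : ℝ)) := by
      rw [Real.rpow_neg hd0.le, show (2 : ℝ) = ((2 : ℕ) : ℝ) by norm_num, Real.rpow_natCast,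
        div_le_iff₀ (by positivity)]
      field_simp
      norm_num
      linarith
    have e3 : d ^ (-(2 : ℝ)) ≤ d ^ (-(1 / 2) : ℝ) :=
      Real.rpow_le_rpow_of_exponent_le hd (by norm_num)
    rw [e1]
    calc Real.pi / c * m ^ 3 * ((d + 1) / d ^ 3)
        ≤ Real.pi / c * m ^ 3 * (2 * d ^ (-(1 / 2) : ℝ)) := by
          gcongr; linarith
      _ = _ := by ring
  have h4 : Real.log Λ / s₀ ≤ K * (m ^ (1 / 2 : ℝ) * X) *
      (2 * Real.pi / c * (m ^ 3 * d ^ (-(1 / 2) : ℝ))) := by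
    rw [div_eq_mul_one_div]
    exact mul_le_mul hX h3 (by positivity) (hL0.trans hX)
  have h5 : m ^ (7 / 2 : ℝ) = m ^ (1 / 2 : ℝ) * m ^ 3 := by
    rw [← Real.rpow_natCast m 3, ← Real.rpow_add hm0]; norm_num
  push_cast
  calc 4 * (⌈10 * (Real.log Λ / s₀)⌉₊ : ℝ) ≤ 44 * (Real.log Λ / s₀) := by linarith
    _ ≤ 44 * (K * (m ^ (1 / 2 : ℝ) * X) * (2 * Real.pi / c * (m ^ 3 * d ^ (-(1 / 2) : ℝ)))) := by
        gcongr
    _ = _ := by rw [h5]; ring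

lemma mul_three_div_le {m h a : ℝ} (hm : 1 ≤ m) (hh : 0 < h) :
    h * (3 / (3 * (m * h) ^ (a + 1))) ≤ (m * h) ^ (-a) := by
  have hm0 : 0 < m := by linarith
  have hmh : 0 < m * h := by positivity
  have hp : 0 < (m * h) ^ a := Real.rpow_pos_of_pos hmh a
  rw [Real.rpow_add hmh, Real.rpow_one, Real.rpow_neg hmh.le]
  have : h * (3 / (3 * ((m * h) ^ a * (m * h)))) = ((m * h) ^ a)⁻¹ * m⁻¹ := by
    field_simp
  rw [this]
  exact mul_le_of_le_one_right (by positivity) (inv_le_one_of_one_le₀ hm)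

end FullGraphGNN

open FullGraphGNN in
theorem theoremB4 (M a c : ℝ) (hM : 0 < M) (ha : 0 < a) (hc : 0 < c) (hc' : c < 1 / 6) :
    ∃ C : ℝ, 0 < C ∧
      ∀ (r h : ℕ) (κ : ℝ), 2 ≤ r → 2 ≤ h → 0 < κ → κ * √(r : ℝ) ≤ M →
      ∀ C₁ ∈ Set.Ioo (0 : ℝ) 1, ∀ C₂ ∈ Set.Ioo (0 : ℝ) 1,
      ∀ (n : ℕ) (G : SimpleGraph (Fin n)) [DecidableRel G.Adj] (train : Finset (Fin n))
        (dOut : Fin n → ℕ),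
        (dOut = (fun k => G.degree k) ∨ dOut = trainOutDegree G train) →
        C₁ ≤ (G.maxDegree : ℝ) →
        (G.maxDegree : ℝ) ≤ C₂ * (train.card : ℝ) ^ (3 / 4 : ℝ) →
      ∀ Wstar : Matrix (Fin h) (Fin r) ℝ, (∀ j, √(∑ l, Wstar j l ^ 2) = 1) →
      ∀ η : ℕ → ℝ,
        (∀ t, η t ∈ Set.Icc (c * (G.maxDegree : ℝ) ^ 3 / (Real.pi * (train.card : ℝ) ^ 3))
          (1 / (6 * Real.pi * (G.maxDegree : ℝ)))) →
      ∀ ε ∈ Set.Ioo (0 : ℝ) 1,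
        ∃ T : ℕ,
          (T : ℝ) ≤ C * ((train.card : ℝ) ^ (7 / 2 : ℝ) * (h : ℝ) ^ 2 *
            (G.maxDegree : ℝ) ^ (-(1 / 2) : ℝ) * ε⁻¹ * Real.log ((h : ℝ) ^ 2 / ε)) ∧
          initLaw h r κ
            {W₀ | ¬ ((∀ t, DifferentiableAt ℝ (trainRisk (normAdj G train dOut) Wstar)
                  (gradDescent (trainRisk (normAdj G train dOut) Wstar) η W₀ t)) ∧
                ∀ t, T ≤ t → trainRisk (normAdj G train dOut) Wstar
                  (gradDescent (trainRisk (normAdj G train dOut) Wstar) η W₀ t) ≤ ε)}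
            ≤ ENNReal.ofReal (((train.card : ℝ) * (h : ℝ)) ^ (-a)) := by
  have hK : 0 < Real.log (9 * (M + 1)) + 3 * Real.log 3 + 9 * (a + 1) + 1 := by
    have h1 : 0 ≤ Real.log (9 * (M + 1)) := Real.log_nonneg (by linarith)
    have h2 : 0 ≤ Real.log 3 := Real.log_nonneg (by norm_num)
    linarith
  set K := Real.log (9 * (M + 1)) + 3 * Real.log 3 + 9 * (a + 1) + 1 with hKdef
  refine ⟨88 * Real.pi * K / c, by positivity, ?_⟩
  intro r h κ hr hh hκ hκM C₁ hC₁ C₂ hC₂ n G _ train dOut hdOut hd hdm Wstar hWstar η hη ε hε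
  have hd1 : (1 : ℝ) ≤ G.maxDegree := by
    have : 0 < G.maxDegree := by
      have : (0 : ℝ) < G.maxDegree := hC₁.1.trans_le hd
      exact_mod_cast this
    exact_mod_cast this
  have hcard : 0 < train.card := by
    by_contra hcon
    have h0 : train.card = 0 := by omega
    rw [h0, Nat.cast_zero, Real.zero_rpow (by norm_num)] at hdm
    linarith
  have hm1 : (1 : ℝ) ≤ train.card := by exact_mod_cast hcard
  have hdm' : (G.maxDegree : ℝ) ≤ train.card := by
    have h1 : (train.card : ℝ) ^ (3 / 4 : ℝ) ≤ (train.card : ℝ) ^ (1 : ℝ) :=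
      Real.rpow_le_rpow_of_exponent_le hm1 (by norm_num)
    rw [Real.rpow_one] at h1
    exact hdm.trans ((mul_le_of_le_one_left (by positivity) hC₂.2.le).trans h1)
  have hh2 : (2 : ℝ) ≤ h := by exact_mod_cast hh
  have hout : ∀ k, dOut k ≤ G.maxDegree := by
    rcases hdOut with rfl | rfl
    · exact fun k => G.degree_le_maxDegree k
    · exact trainOutDegree_le G train
  have hstar : ∀ j, ‖(WithLp.toLp 2 (Wstar j) : EuclideanSpace ℝ (Fin r))‖ = 1 := by
    intro j
    rw [EuclideanSpace.norm_eq, ← hWstar j]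
    simp
  obtain ⟨hε0, hε1⟩ := hε
  have hpi := Real.pi_pos
  set m : ℝ := (train.card : ℝ)
  set d : ℝ := (G.maxDegree : ℝ)
  -- each row is bad with probability at most `3 / B`, so `h` rows fit into `(m h)^(-a)`
  set B : ℝ := 3 * (m * h) ^ (a + 1) with hB
  have hB1 : 1 ≤ B := by
    have : 1 ≤ (m * h) ^ (a + 1) :=
      Real.one_le_rpow (one_le_mul_of_one_le_of_one_le hm1 (by linarith)) (by linarith)
    rw [hB]; linarith
  -- the factor by which each block of steps has to contract
  set Λ : ℝ := 9 * (M + 1) * B ^ 3 * (h / ε) with hΛ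
  have hB3 : B ≤ B ^ 3 := le_self_pow₀ hB1 (by norm_num)
  have hhε : 1 ≤ h / ε := by rw [le_div_iff₀ hε0]; linarith
  have hΛ9 : 9 ≤ Λ := by
    have h1 : 9 ≤ 9 * (M + 1) * B ^ 3 := by nlinarith
    rw [hΛ]; nlinarith
  have hlogΛ : 1 ≤ Real.log Λ := by
    rw [Real.le_log_iff_exp_le (by linarith)]
    linarith [Real.exp_one_lt_d9]
  -- the smallest effective step size
  set s₀ : ℝ := c * d ^ 3 / (Real.pi * m ^ 3) * (d + 1)⁻¹ with hs₀
  have hs₀0 : 0 < s₀ := by positivity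
  set N := ⌈10 * Real.log Λ / s₀⌉₊ with hN
  have hSle : meanRowSq (normAdj G train dOut) ≤ 1 := meanRowSq_normAdj_le_one G train
  have hSge := le_meanRowSq_normAdj G train hout (Finset.card_pos.mp hcard)
  have hS0 : 0 ≤ meanRowSq (normAdj G train dOut) := le_trans (by positivity) hSge
  have hη0 : ∀ t, 0 ≤ η t := fun t => le_trans (by positivity) (hη t).1
  have hs : ∀ t, s₀ ≤ η t * meanRowSq (normAdj G train dOut) := fun t =>
    mul_le_mul (hη t).1 hSge (by positivity) (hη0 t)
  have hs1 : ∀ t, η t * meanRowSq (normAdj G train dOut) < 1 := by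
    intro t
    have h1 : η t < 1 := by
      refine (hη t).2.trans_lt ?_
      rw [div_lt_one (by positivity)]
      have h3 := Real.pi_gt_three
      have : 18 * 1 ≤ 6 * Real.pi * d := mul_le_mul (by linarith) hd1 (by norm_num) (by positivity)
      linarith
    exact (mul_le_of_le_one_right (hη0 t) hSle).trans_lt h1
  have hq : (1 - s₀ / 10) ^ N ≤ Λ⁻¹ := by
    refine one_sub_pow_le_inv ?_ (by linarith) ?_
    · have := (hs 0).trans_lt (hs1 0)
      linarith
    · have h1 := Nat.le_ceil (10 * Real.log Λ / s₀)
      rw [div_le_iff₀ hs₀0] at h1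
      rw [hN]
      linarith
  refine ⟨4 * N, ?_, ?_⟩
  · have h1 := log_target_le hM ha hm1 hh2 hε0 hε1
    rw [← hB, ← hΛ, ← hKdef] at h1
    have h2 := four_mul_ceil_le (X := (h : ℝ) ^ 2 * ε⁻¹ * Real.log ((h : ℝ) ^ 2 / ε)) (K := K)
      hc (by linarith) hd1 hm1 hdm' hlogΛ (h1.trans_eq (by ring))
    refine h2.trans_eq ?_
    ring
  · refine le_trans (measure_mono ?_) ((initLaw_bad_le hr hκ hM hB1 hκM hstar).trans
      (ENNReal.ofReal_le_ofReal (mul_three_div_le hm1 (by linarith))))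
    intro W₀ hW₀ hgood
    apply hW₀
    have hκB : 0 < κ / B := div_pos hκ (by linarith)
    have hMB : 0 ≤ M * B := by positivity
    have hinner : ∀ j, |inner ℝ (rowL h r j W₀) (WithLp.toLp 2 (Wstar j))| ≤ M * B := by
      intro j
      have h1 := abs_real_inner_le_norm (rowL h r j W₀) (WithLp.toLp 2 (Wstar j))
      rw [hstar j, mul_one] at h1
      exact h1.trans (hgood j).2.2
    have hres := trainRisk_gradDescent_le (normAdj G train dOut) hSle hstar hs₀0 hs hs1
      (W₀ := W₀) (N := N) (P := B ^ 2) (Q := M * B) (D := ε / h) (one_le_pow₀ hB1) hMB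
      (fun j => hκB.trans_le (hgood j).1)
      (fun j => by
        refine (hgood j).2.1.trans ?_
        have h1 := mul_le_mul_of_nonneg_left (hgood j).1 (show 0 ≤ B ^ 2 by positivity)
        refine le_trans (le_of_eq ?_) h1
        field_simp)
      hinner (fun j => (perpNorm_le_norm (hstar j) _).trans (hgood j).2.2)
      (by
        refine (mul_le_mul_of_nonneg_right hq (by positivity)).trans ?_
        rw [inv_mul_le_iff₀ (by linarith), mul_one]
        have h1 : 2 * B ^ 2 * (M * B + 1) ≤ 9 * (M + 1) * B ^ 3 := by
          have h2 : B ^ 2 * 1 ≤ B ^ 2 * B := by gcongr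
          have h3 : 0 ≤ M * B ^ 3 := by positivity
          have h4 : 0 ≤ B ^ 3 := by positivity
          linarith
        exact h1.trans (le_mul_of_one_le_right (by positivity) hhε))
      (by
        refine (mul_le_mul_of_nonneg_right hq (by positivity)).trans ?_
        rw [inv_mul_le_iff₀ (by linarith)]
        have h1 : Λ * (ε / h) = 9 * (M + 1) * B ^ 3 := by
          rw [hΛ]; field_simp
        rw [h1]
        have h2 : M * B ≤ M * B ^ 3 := by gcongr
        linarith)
    refine ⟨hres.1, fun t ht => (hres.2 t ht).trans ?_⟩
    have h1 : (h : ℝ) * (ε / h) ^ 2 / 2 = ε * (ε / (2 * h)) := by field_simp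
    rw [h1]
    refine mul_le_of_le_one_right hε0.le ?_
    rw [div_le_one (by positivity)]
    linarith
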